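/- Let $\gamma$ be a connected, smooth, complete immersed curve without boundary in $\mathbf{R}^2$, that is, a smooth immersion $x : M \to \mathbf{R}^2$ with $M=\mathbf{R}$ or $M=\mathbf{R}/\ell\mathbf{Z}$, $\ell>0$, complete in the induced metric (self-intersections and multiple coverings are allowed). Let $s$ be arc length, $T$ the unit tangent, $(\cdot)^\perp$ the normal part, $\nabla^\perp_T u=(du/ds)^\perp$ and $\mathbf{H}=\nabla^\perp_T T$ the mean curvature (curvature) vector. The curve is a *shrinker* if $\mathbf{H}=-\tfrac12 x^\perp$. Put $$F(\gamma)=(4\pi)^{-1/2}\int_\gamma e^{-|x|^2/4}\,ds,\qquad \lambda(\gamma)=\sup_{c>0,\;x_0\in\mathbf{R}^2}F(c\,\gamma+x_0),$$ where integrals are taken over $M$, i.e. with multiplicity; $\lambda(\gamma)$ is the *entropy*. On normal vector fields $u$ along $\gamma$ let $$L u=\nabla^\perp_T\nabla^\perp_T u-\tfrac12\langle x,T\rangle\nabla^\perp_T u+\tfrac12 u+\langle u,\mathbf{H}\rangle\mathbf{H},\qquad \delta^2(u)=-(4\pi)^{-1/2}\int_\gamma\langle u,Lu\rangle\,e^{-|x|^2/4}\,ds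 .$$ A shrinker is *$F$-stable* if $\delta^2(u)\ge 0$ for every smooth normal vector field $u$ with compact support in $M$ such that $\int_\gamma\langle u,\mathbf{H}\rangle e^{-|x|^2/4}\,ds=0$ and $\int_\gamma\langle u,V^\perp\rangle e^{-|x|^2/4}\,ds=0$ for all $V\in\mathbf{R}^2$. Then: if $\gamma$ is an $F$-stable shrinker with $\lambda(\gamma)<\infty$, then $\gamma$ is either a line through the origin or the circle of radius $\sqrt2$ centred at the origin, covered exactly once (that is, $x$ is injective on $M$ and its image is that line or that circle). -/

import Mathlib

open Set MeasureTheory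
open scoped ContDiff RealInnerProductSpace ENNReal

noncomputable section

/-- A connected smooth immersed curve without boundary in a Euclidean space `E`, given by a regular
parametrization (not assumed to be by arc length). The parameter manifold is `ℝ / (period • ℤ)`: the
real line if `period = 0` (an open curve) and a circle if `period > 0` (a closed curve). Maps on the
parameter manifold are represented by `period`-periodic maps on `ℝ`. Self-intersections and
multiple coverings are allowed. -/
structure ImmersedCurve (E : Type*) [NormedAddCommGroup E] [InnerProductSpace ℝ E] where
  toFun : ℝ → E
  period : ℝ
  period_nonneg : 0 ≤ period
  periodic : Function.Periodic toFun period
  smooth : ContDiff ℝ ∞ toFun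
  regular : ∀ t, deriv toFun t ≠ 0

namespace ImmersedCurve

variable {E : Type*} [NormedAddCommGroup E] [InnerProductSpace ℝ E]

instance : CoeFun (ImmersedCurve E) (fun _ => ℝ → E) := ⟨ImmersedCurve.toFun⟩

/-- A fundamental domain of the parameter manifold `ℝ / (period • ℤ)`. -/
def domain (γ : ImmersedCurve E) : Set ℝ :=
  if γ.period = 0 then univ else Ico 0 γ.period

/-- Completeness of the induced metric: a closed curve is always complete, an open one is complete
when both of its ends have infinite length. -/
def IsComplete (γ : ImmersedCurve E) : Prop :=
  γ.period = 0 →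
    (∫⁻ t in Ici (0 : ℝ), ‖deriv γ t‖ₑ) = ⊤ ∧ (∫⁻ t in Iic (0 : ℝ), ‖deriv γ t‖ₑ) = ⊤

/-- The curve `a γ + x₀`, for a dilation factor `a > 0` and a translation vector `x₀`. -/
def dilateTranslate (γ : ImmersedCurve E) (a : ℝ) (ha : 0 < a) (x₀ : E) : ImmersedCurve E where
  toFun := fun t => a • γ t + x₀
  period := γ.period
  period_nonneg := γ.period_nonneg
  periodic := fun t => by simp only [γ.periodic t]
  smooth := (γ.smooth.const_smul a).add contDiff_const
  regular := fun t => by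
    have hd : DifferentiableAt ℝ γ.toFun t := (γ.smooth.differentiable (by simp)) t
    have h : deriv (fun t => a • γ t + x₀) t = a • deriv γ t := by
      rw [deriv_add_const]
      exact deriv_fun_const_smul a hd
    rw [h]
    exact smul_ne_zero ha.ne' (γ.regular t)

/-- The Gaussian length `F(γ) = (4π)^{-1/2} ∫_γ e^{-|x|²/4} ds`, with values in `[0, ∞]`. -/
def gaussianLength (γ : ImmersedCurve E) : ℝ≥0∞ :=
  ENNReal.ofReal ((Real.sqrt (4 * Real.pi))⁻¹) *
    ∫⁻ t in γ.domain, ENNReal.ofReal (Real.exp (-(‖γ t‖ ^ 2 / 4)) * ‖deriv γ t‖)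

/-- The entropy: the supremum of the Gaussian length over all dilations and translations. -/
def entropy (γ : ImmersedCurve E) : ℝ≥0∞ :=
  ⨆ (a : ℝ) (ha : 0 < a) (x₀ : E), (γ.dilateTranslate a ha x₀).gaussianLength

/-- The derivative `du/ds` with respect to arc length of a vector field `u` along `γ`. -/
def arcDeriv (γ : ImmersedCurve E) (u : ℝ → E) : ℝ → E :=
  fun t => ‖deriv γ t‖⁻¹ • deriv u t

/-- The unit tangent vector field. -/
def tangent (γ : ImmersedCurve E) : ℝ → E :=
  γ.arcDeriv γ

/-- The normal part `u^⊥` of a vector field `u` along `γ`. -/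
def normalPart (γ : ImmersedCurve E) (u : ℝ → E) : ℝ → E :=
  fun t => u t - ⟪u t, γ.tangent t⟫ • γ.tangent t

/-- The normal covariant derivative `∇^⊥_T u` in the direction of the unit tangent `T`. -/
def normalDeriv (γ : ImmersedCurve E) (u : ℝ → E) : ℝ → E :=
  γ.normalPart (γ.arcDeriv u)

/-- The mean curvature vector. In dimension one it is the only component `A(T, T) = ∇^⊥_T T` of
the second fundamental form. It points to the centre on a round circle. -/
def meanCurvature (γ : ImmersedCurve E) : ℝ → E :=
  γ.normalDeriv γ.tangent

/-- Shrinkers: the mean curvature vector is `-x^⊥ / 2`, so that the curve moves by homothetic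
shrinking under the curve shortening flow. -/
def IsShrinker (γ : ImmersedCurve E) : Prop :=
  ∀ t, γ.meanCurvature t = -((1 / 2 : ℝ) • γ.normalPart γ t)

/-- The Gaussian integral `(4π)^{-1/2} ∫_γ g e^{-|x|²/4} ds` of a function `g` on `γ`. -/
def gaussianIntegral (γ : ImmersedCurve E) (g : ℝ → ℝ) : ℝ :=
  (Real.sqrt (4 * Real.pi))⁻¹ *
    ∫ t in γ.domain, g t * Real.exp (-(‖γ t‖ ^ 2 / 4)) * ‖deriv γ t‖

/-- The drift Laplacian `ℒ u = Δ u - ½ ∇_{x^T} u` on normal vector fields. -/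
def driftLaplacian (γ : ImmersedCurve E) (u : ℝ → E) : ℝ → E :=
  fun t => γ.normalDeriv (γ.normalDeriv u) t -
    (1 / 2 : ℝ) • (⟪γ t, γ.tangent t⟫ • γ.normalDeriv u t)

/-- The second variation operator `L u = ℒ u + ½ u + ⟨u, A⟩ A` on normal vector fields, where
`A = A(T, T)`. -/
def stabilityOperator (γ : ImmersedCurve E) (u : ℝ → E) : ℝ → E :=
  fun t => γ.driftLaplacian u t + (1 / 2 : ℝ) • u t +
    ⟪u t, γ.meanCurvature t⟫ • γ.meanCurvature t

/-- The second variation `δ²(u) = -(4π)^{-1/2} ∫_γ ⟨u, L u⟩ e^{-|x|²/4} ds`. -/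
def secondVariation (γ : ImmersedCurve E) (u : ℝ → E) : ℝ :=
  -γ.gaussianIntegral (fun t => ⟪u t, γ.stabilityOperator u t⟫)

/-- Smooth normal vector fields with compact support on the parameter manifold of `γ` (for a closed
curve the support is automatically compact). -/
structure IsNormalVariation (γ : ImmersedCurve E) (u : ℝ → E) : Prop where
  smooth : ContDiff ℝ ∞ u
  periodic : Function.Periodic u γ.period
  normal : ∀ t, ⟪u t, deriv γ t⟫ = 0
  compactSupport : γ.period = 0 → HasCompactSupport u

/-- `F`-stability: the second variation is nonnegative on all normal variations that are orthogonal,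
in the Gaussian `L²` inner product, to the mean curvature vector (the dilation direction) and to the
normal parts of all constant vectors (the translation directions). -/
def IsFStable (γ : ImmersedCurve E) : Prop :=
  ∀ u : ℝ → E, γ.IsNormalVariation u →
    γ.gaussianIntegral (fun t => ⟪u t, γ.meanCurvature t⟫) = 0 →
    (∀ V : E, γ.gaussianIntegral (fun t => ⟪u t, γ.normalPart (fun _ => V) t⟫) = 0) →
    0 ≤ γ.secondVariation u

end ImmersedCurve

end

/-! The proof rests on a first integral. With signed curvature $\kappa$, a shrinker satisfies
$\langle x,N\rangle=-2\kappa$ and $\kappa_s=\tfrac12\kappa\langle x,T\rangle$, so $\kappa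
e^{-|x|^2/4}$ is a constant $C$ (`exists_curvature_mul_exp`). If $C=0$, the curve is straight, and
completeness makes it a whole line through the origin. If $C\ne0$, then $\kappa$ has a fixed sign
and $4\kappa^2\le|x|^2$ bounds the weight $e^{-|x|^2/4}$ below. An open complete curve has infinite
length, hence would have infinite entropy, so the curve is closed (`period_pos`). Its tangent angle
$\theta$ is strictly monotone and turns by $2\pi m$ with $m\ne0$.

Stability serves to exclude $|m|\ge2$ (`sq_turning_lt`). On fields $F(\theta)N$ the first integral
turns $\kappa^2e^{-|x|^2/4}ds$ into $C\,d\theta$, so up to a positive factor $-\delta^2$ is $C\int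
F(F''+F)\,d\theta+\tfrac12\int F^2e^{-|x|^2/4}ds$. On the span of
$1,\cos(\theta/m),\sin(\theta/m),\cos\theta$ this is positive definite when $m^2>1$. Since the span
has dimension four and there are only three orthogonality conditions, some nonzero admissible field
has negative second variation.

For $m=\pm1$ the function $p=2|\kappa|$, the support function up to sign, is $2\pi$-periodic in the
angle and solves $p''+p=2/p$. It must be constant (`eq_sqrt_two`). Solutions are symmetric about
critical points, so these come in antipodal pairs; a four vertex argument yields a further one in
between, hence two at distance at most $\pi/2$. Between these, a Bonnesen type inequality obtained
from Wirtinger's holds with equality, which makes $p$ constant there, and then everywhere by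
uniqueness for the equation. -/

/-- Forward uniqueness for the linear equation `w'' = -c w` with vanishing initial data. -/
theorem eq_zero_of_linear_ode {w w' c : ℝ → ℝ} (hw : ∀ t, HasDerivAt w (w' t) t)
    (hw' : ∀ t, HasDerivAt w' (-(c t * w t)) t) (hc : Continuous c) {t₀ : ℝ} (h0 : w t₀ = 0)
    (h0' : w' t₀ = 0) {t : ℝ} (ht : t₀ ≤ t) : w t = 0 := by
  obtain ⟨K, hK⟩ := (isCompact_Icc (a := t₀) (b := t)).exists_bound_of_continuousOn
    (f := fun s => 1 - c s) (by fun_prop)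
  -- Grönwall: the energy $w^2+w'^2$ grows at rate at most $K$, as its derivative is $2ww'(1-c)$ and
  -- $K$ bounds $|1-c|$ on $[t_0,t]$.
  set G : ℝ → ℝ := fun s => (w s ^ 2 + w' s ^ 2) * Real.exp (-(K * s)) with hG
  have hd : ∀ s, HasDerivAt G ((2 * (w s * w' s * (1 - c s)) - K * (w s ^ 2 + w' s ^ 2)) *
      Real.exp (-(K * s))) s := by
    intro s
    have h1 : HasDerivAt (fun s => Real.exp (-(K * s))) (Real.exp (-(K * s)) * (-(K * 1))) s :=
      (((hasDerivAt_id s).const_mul K).neg).exp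
    refine HasDerivAt.congr_deriv ((((hw s).pow 2).add ((hw' s).pow 2)).mul h1) ?_
    simp only [Pi.add_apply, Pi.pow_apply]
    ring
  have hanti : AntitoneOn G (Icc t₀ t) := by
    refine antitoneOn_of_deriv_nonpos (convex_Icc _ _)
      (fun s _ => (hd s).continuousAt.continuousWithinAt)
      (fun s _ => (hd s).differentiableAt.differentiableWithinAt) fun s hs => ?_
    rw [interior_Icc] at hs
    rw [(hd s).deriv]
    refine mul_nonpos_of_nonpos_of_nonneg ?_ (Real.exp_pos _).le
    have hb := abs_le.mp (hK s ⟨hs.1.le, hs.2.le⟩)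
    have h2 : 2 * |w s * w' s| ≤ w s ^ 2 + w' s ^ 2 := by
      rw [abs_mul, ← sq_abs (w s), ← sq_abs (w' s)]
      nlinarith [sq_nonneg (|w s| - |w' s|)]
    have h3 : w s * w' s * (1 - c s) ≤ |w s * w' s| * K := by
      refine (le_abs_self _).trans ?_
      rw [abs_mul]
      exact mul_le_mul_of_nonneg_left (abs_le.mpr hb) (abs_nonneg _)
    have hK0 : 0 ≤ K := by linarith [hb.1, hb.2]
    nlinarith
  have h1 : G t ≤ G t₀ := hanti ⟨le_rfl, ht⟩ ⟨ht, le_rfl⟩ ht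
  have h2 : G t₀ = 0 := by simp [hG, h0, h0']
  rw [h2] at h1
  have h3 : w t ^ 2 + w' t ^ 2 ≤ 0 := by
    by_contra hcon
    push Not at hcon
    exact absurd h1 (not_le.mpr (mul_pos hcon (Real.exp_pos _)))
  nlinarith [sq_nonneg (w t), sq_nonneg (w' t)]

/-! ### The support function equation: uniqueness, symmetry and critical points -/

/-- A positive solution `p`, with derivative `r`, of the equation `p'' + p = 2 / p` satisfied by the
support function of a convex shrinker as a function of the tangent angle. -/
structure IsSupportSolution (p r : ℝ → ℝ) : Prop where
  pos : ∀ t, 0 < p t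
  hasDerivAt : ∀ t, HasDerivAt p (r t) t
  hasDerivAt' : ∀ t, HasDerivAt r (2 / p t - p t) t

namespace IsSupportSolution

variable {p r P R : ℝ → ℝ}

theorem continuous (h : IsSupportSolution p r) : Continuous p :=
  continuous_iff_continuousAt.mpr fun t => (h.hasDerivAt t).continuousAt

theorem continuous' (h : IsSupportSolution p r) : Continuous r :=
  continuous_iff_continuousAt.mpr fun t => (h.hasDerivAt' t).continuousAt

/-- The nonlinear equation has a linear difference: $2/p-2/P=-2(p-P)/(pP)$, so $w=p-P$ solves
$w''=-(1+2/(pP))\,w$ with a continuous coefficient. -/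
theorem eq_of_le (h : IsSupportSolution p r) (H : IsSupportSolution P R) {t₀ : ℝ}
    (h0 : p t₀ = P t₀) (h0' : r t₀ = R t₀) {t : ℝ} (ht : t₀ ≤ t) : p t = P t := by
  have hc : Continuous fun t => 1 + 2 / (p t * P t) :=
    continuous_const.add (continuous_const.div (h.continuous.mul H.continuous)
      fun t => (mul_pos (h.pos t) (H.pos t)).ne')
  refine sub_eq_zero.mp (eq_zero_of_linear_ode (w := fun t => p t - P t)
    (w' := fun t => r t - R t) (fun t => (h.hasDerivAt t).sub (H.hasDerivAt t)) (fun t => ?_) hc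
    (sub_eq_zero.mpr h0) (sub_eq_zero.mpr h0') ht)
  refine HasDerivAt.congr_deriv ((h.hasDerivAt' t).sub (H.hasDerivAt' t)) ?_
  have := (h.pos t).ne'
  have := (H.pos t).ne'
  field_simp
  ring

theorem reflect (h : IsSupportSolution p r) (a : ℝ) :
    IsSupportSolution (fun t => p (a - t)) (fun t => -r (a - t)) where
  pos t := h.pos _
  hasDerivAt t := (h.hasDerivAt (a - t)).comp_const_sub a t
  hasDerivAt' t := by
    refine HasDerivAt.congr_deriv ((h.hasDerivAt' (a - t)).comp_const_sub a t).neg ?_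
    ring

theorem const : IsSupportSolution (fun _ => √2) (fun _ => 0) where
  pos _ := by positivity
  hasDerivAt t := hasDerivAt_const _ _
  hasDerivAt' t := by simpa using hasDerivAt_const t (0 : ℝ)

/-- A solution is symmetric about its critical points. -/
theorem symm_of_critical (h : IsSupportSolution p r) {c : ℝ} (hc : r c = 0) (t : ℝ) :
    p t = p (2 * c - t) := by
  have key : ∀ t, c ≤ t → p t = p (2 * c - t) := fun t ht =>
    h.eq_of_le (h.reflect (2 * c)) (t₀ := c) (by ring_nf) (by ring_nf; simp [hc]) ht
  rcases le_total c t with ht | ht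
  · exact key t ht
  · have := key (2 * c - t) (by linarith)
    rw [this]
    ring_nf

theorem periodic' (h : IsSupportSolution p r) {T : ℝ} (hper : Function.Periodic p T) :
    Function.Periodic r T := by
  intro t
  have h1 : HasDerivAt (fun s => p (s + T)) (r (t + T)) t := (h.hasDerivAt _).comp_add_const t T
  rw [show (fun s => p (s + T)) = p from funext hper] at h1
  exact h1.unique (h.hasDerivAt t)

/-- Symmetry about $c$ combined with period $2\pi$ is symmetry about $c+\pi$ as well. -/
theorem critical_add_pi (h : IsSupportSolution p r) (hper : Function.Periodic p (2 * Real.pi))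
    {c : ℝ} (hc : r c = 0) : r (c + Real.pi) = 0 := by
  have h1 : HasDerivAt (fun t => p (2 * c - t)) (-r (2 * c - (c + Real.pi))) (c + Real.pi) :=
    (h.hasDerivAt _).comp_const_sub _ _
  rw [show (fun t => p (2 * c - t)) = p from funext fun t => (h.symm_of_critical hc t).symm] at h1
  have h2 := h1.unique (h.hasDerivAt _)
  have h3 := h.periodic' hper (2 * c - (c + Real.pi))
  rw [show 2 * c - (c + Real.pi) + 2 * Real.pi = c + Real.pi by ring] at h3
  linarith

/-- The four vertex property: between antipodal critical points there is a further one. -/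
theorem exists_critical_between (h : IsSupportSolution p r) {c : ℝ} (hc : r c = 0)
    (hc' : r (c + Real.pi) = 0) : ∃ a ∈ Ioo c (c + Real.pi), r a = 0 := by
  -- Chosen so that the equation leaves only $G'=2rp^{-2}\sin(t-c)$. As $G$ vanishes at both ends,
  -- Rolle's theorem gives an interior zero of $G'$, where the sine is positive. This is the
  -- classical four vertex argument with $2/p$ as radius of curvature.
  set G : ℝ → ℝ := fun t => r t * Real.cos (t - c) + (p t - 2 / p t) * Real.sin (t - c) with hG
  have hd : ∀ t, HasDerivAt G (2 * r t / p t ^ 2 * Real.sin (t - c)) t := by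
    intro t
    have hcos : HasDerivAt (fun t => Real.cos (t - c)) (-Real.sin (t - c)) t :=
      (Real.hasDerivAt_cos _).comp_sub_const t c
    have hsin : HasDerivAt (fun t => Real.sin (t - c)) (Real.cos (t - c)) t :=
      (Real.hasDerivAt_sin _).comp_sub_const t c
    have hp0 := (h.pos t).ne'
    have hdiv : HasDerivAt (fun t => 2 / p t) (-(2 * r t) / p t ^ 2) t := by
      refine HasDerivAt.congr_deriv ((hasDerivAt_const t (2 : ℝ)).div (h.hasDerivAt t) hp0) ?_
      simp
    refine HasDerivAt.congr_deriv (((h.hasDerivAt' t).mul hcos).add (((h.hasDerivAt t).sub hdiv).mul hsin)) ?_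
    simp only [Pi.sub_apply]
    ring
  obtain ⟨a, ha, hGa⟩ := exists_hasDerivAt_eq_zero (f := G) (lt_add_of_pos_right c Real.pi_pos)
    (fun t _ => (hd t).continuousAt.continuousWithinAt) (by simp [hG, hc, hc'])
    (fun t _ => hd t)
  refine ⟨a, ha, ?_⟩
  have hs : Real.sin (a - c) ≠ 0 :=
    (Real.sin_pos_of_pos_of_lt_pi (by linarith [ha.1]) (by linarith [ha.2])).ne'
  have hp0 := (h.pos a).ne'
  simpa [hs, hp0] using hGa

end IsSupportSolution

/-! ### Wirtinger's inequality and the equality case of Bonnesen's inequality -/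

/-- Wirtinger's inequality as an identity, for a function that vanishes at one end of an interval
shorter than `π / 2`. -/
theorem integral_deriv_sq_sub_sq {g g' : ℝ → ℝ} (hg : ∀ t, HasDerivAt g (g' t) t)
    (hg' : Continuous g') {α b : ℝ} (hα : g α = 0) (hαb : |α - b| < Real.pi / 2) :
    ∫ t in b..α, (g' t ^ 2 - g t ^ 2) = ∫ t in b..α, (g' t + Real.tan (t - b) * g t) ^ 2 := by
  have hgc : Continuous g := continuous_iff_continuousAt.mpr fun t => (hg t).continuousAt
  have hcos : ∀ t ∈ uIcc b α, Real.cos (t - b) ≠ 0 := by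
    intro t ht
    have := abs_sub_left_of_mem_uIcc ht
    have h2 := abs_lt.mp (this.trans_lt hαb)
    exact (Real.cos_pos_of_mem_Ioo ⟨by linarith [h2.1], h2.2⟩).ne'
  have htanc : ContinuousOn (fun t => Real.tan (t - b)) (uIcc b α) := fun t ht =>
    ((Real.continuousAt_tan.mpr (hcos t ht)).comp
      (f := fun t => t - b) (by fun_prop)).continuousWithinAt
  have hi1 : IntervalIntegrable (fun t => (g' t + Real.tan (t - b) * g t) ^ 2) volume b α :=
    ((hg'.continuousOn.add (htanc.mul hgc.continuousOn)).pow 2).intervalIntegrable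
  have hi2 : IntervalIntegrable (fun t => g' t ^ 2 - g t ^ 2) volume b α :=
    (by fun_prop : Continuous fun t => g' t ^ 2 - g t ^ 2).intervalIntegrable _ _
  -- The tangent solves the Riccati equation $\tau'=1+\tau^2$, so the difference of the two
  -- integrands is the derivative of $\tan(t-b)\,g^2$. This vanishes at $b$ because $\tan0=0$, and
  -- at $\alpha$ because $g(\alpha)=0$.
  have hd : ∀ t ∈ uIcc b α, HasDerivAt (fun t => Real.tan (t - b) * g t ^ 2)
      ((g' t + Real.tan (t - b) * g t) ^ 2 - (g' t ^ 2 - g t ^ 2)) t := by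
    intro t ht
    have h1 : HasDerivAt (fun t => Real.tan (t - b)) (1 / Real.cos (t - b) ^ 2) t :=
      (Real.hasDerivAt_tan (hcos t ht)).comp_sub_const t b
    refine HasDerivAt.congr_deriv (h1.mul ((hg t).pow 2)) ?_
    have h2 : 1 / Real.cos (t - b) ^ 2 = 1 + Real.tan (t - b) ^ 2 := by
      rw [one_div, ← Real.inv_one_add_tan_sq (hcos t ht), inv_inv]
    rw [h2]
    simp
    ring
  have h := intervalIntegral.integral_eq_sub_of_hasDerivAt hd (hi1.sub hi2)
  rw [intervalIntegral.integral_sub hi1 hi2] at h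
  simp [hα] at h
  linarith

namespace IsSupportSolution

variable {p r : ℝ → ℝ}

/-- A solution with two critical points at distance at most `π / 2` is constant in between: the
equality case of Bonnesen's inequality. -/
theorem critical_of_mem_Ioo (h : IsSupportSolution p r) {c d : ℝ} (hcd : c < d)
    (hlen : d - c ≤ Real.pi / 2) (hc : r c = 0) (hd : r d = 0) {α : ℝ} (hα : α ∈ Ioo c d) :
    r α = 0 := by
  have hpc := h.continuous
  have hrc := h.continuous'
  have hp0 : ∀ t, p t ≠ 0 := fun t => (h.pos t).ne'
  have hinv : Continuous fun t => 2 / p t := continuous_const.div hpc hp0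
  set Λ := ∫ t in c..d, p t with hΛ
  have hI1 : ∫ t in c..d, 2 / p t = Λ := by
    have h1 := intervalIntegral.integral_eq_sub_of_hasDerivAt (fun t _ => h.hasDerivAt' t)
      ((hinv.sub hpc).intervalIntegrable c d)
    rw [intervalIntegral.integral_sub (hinv.intervalIntegrable _ _) (hpc.intervalIntegrable _ _),
      hc, hd] at h1
    linarith
  have hI2 : ∫ t in c..d, (r t ^ 2 - p t ^ 2 + 2) = 0 := by
    have hder : ∀ t ∈ uIcc c d, HasDerivAt (fun t => p t * r t) (r t ^ 2 - p t ^ 2 + 2) t := by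
      intro t _
      refine HasDerivAt.congr_deriv ((h.hasDerivAt t).mul (h.hasDerivAt' t)) ?_
      have := hp0 t
      field_simp
      ring
    rw [intervalIntegral.integral_eq_sub_of_hasDerivAt hder
      ((by fun_prop : Continuous fun t => r t ^ 2 - p t ^ 2 + 2).intervalIntegrable _ _), hc, hd]
    simp
  -- The Bonnesen quadratic in $p(\beta)$: $\Lambda$ plays the role of length, since it is the
  -- integral both of $p$ and of the radius of curvature $2/p$, and $2(d-c)=\int p\cdot(2/p)$ that
  -- of twice the area.
  set I : ℝ → ℝ := fun β => 2 * Λ * p β - (d - c) * p β ^ 2 - 2 * (d - c) with hI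
  have hIc : Continuous I := by fun_prop
  have hIint : ∀ β, ∫ t in c..d, (r t ^ 2 - (p t - p β) ^ 2) = I β := by
    intro β
    have : ∀ t, r t ^ 2 - (p t - p β) ^ 2 =
        (r t ^ 2 - p t ^ 2 + 2) + (2 * p β * p t - (p β ^ 2 + 2)) := fun t => by ring
    simp_rw [this]
    rw [intervalIntegral.integral_add
      ((by fun_prop : Continuous fun t => r t ^ 2 - p t ^ 2 + 2).intervalIntegrable _ _)
      ((by fun_prop : Continuous fun t => 2 * p β * p t - (p β ^ 2 + 2)).intervalIntegrable _ _),
      hI2, intervalIntegral.integral_sub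
      ((by fun_prop : Continuous fun t => 2 * p β * p t).intervalIntegrable _ _)
      (by simp), intervalIntegral.integral_const_mul]
    simp only [intervalIntegral.integral_const, smul_eq_mul, hI, ← hΛ]
    ring
  -- Wirtinger on each side of $\beta$, with the tangent centred at the far endpoint; both pieces
  -- are shorter than $\pi/2$ because $\beta$ is interior.
  have hsplit : ∀ β ∈ Ioo c d, I β =
      (∫ t in c..β, (r t + Real.tan (t - c) * (p t - p β)) ^ 2) +
      ∫ t in β..d, (r t + Real.tan (t - d) * (p t - p β)) ^ 2 := by
    intro β hβ
    have hder : ∀ t, HasDerivAt (fun t => p t - p β) (r t) t := fun t =>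
      (h.hasDerivAt t).sub_const _
    have e1 := integral_deriv_sq_sub_sq hder hrc (α := β) (b := c) (sub_self _)
      (by rw [abs_lt]; constructor <;> linarith [hβ.1, hβ.2, Real.pi_pos])
    have e2 := integral_deriv_sq_sub_sq hder hrc (α := β) (b := d) (sub_self _)
      (by rw [abs_lt]; constructor <;> linarith [hβ.1, hβ.2, Real.pi_pos])
    rw [intervalIntegral.integral_symm, intervalIntegral.integral_symm β d, neg_inj] at e2
    rw [← e1, ← e2, ← hIint]
    have hcont : Continuous fun t => r t ^ 2 - (p t - p β) ^ 2 := by fun_prop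
    exact (intervalIntegral.integral_add_adjacent_intervals (hcont.intervalIntegrable _ _)
      (hcont.intervalIntegrable _ _)).symm
  have hnn : ∀ β ∈ Ioo c d,
      0 ≤ (∫ t in c..β, (r t + Real.tan (t - c) * (p t - p β)) ^ 2) ∧
      0 ≤ ∫ t in β..d, (r t + Real.tan (t - d) * (p t - p β)) ^ 2 := fun β hβ =>
    ⟨intervalIntegral.integral_nonneg hβ.1.le fun t _ => sq_nonneg _,
      intervalIntegral.integral_nonneg hβ.2.le fun t _ => sq_nonneg _⟩
  have hI0 : ∀ β ∈ Icc c d, 0 ≤ I β := by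
    -- The endpoints are reached by continuity, as the tangents may blow up there when $d-c=\pi/2$.
    have : closure (Ioo c d) ⊆ {β | 0 ≤ I β} := by
      refine closure_minimal (fun β hβ => ?_) (isClosed_le continuous_const hIc)
      rw [mem_ofPred_eq, hsplit β hβ]
      exact add_nonneg (hnn β hβ).1 (hnn β hβ).2
    rwa [closure_Ioo hcd.ne] at this
  -- Averaging the nonnegative $I$ against the length element $2/p$ gives zero, since $\int p=\int
  -- 2/p=\Lambda$. Hence $I$ vanishes identically.
  have hzero : ∫ β in c..d, I β * (2 / p β) = 0 := by
    have : ∀ β, I β * (2 / p β) = (4 * Λ - 2 * (d - c) * p β) - 2 * (d - c) * (2 / p β) := by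
      intro β
      have := hp0 β
      simp only [hI]
      field_simp
      ring
    simp_rw [this]
    rw [intervalIntegral.integral_sub
      ((by fun_prop : Continuous fun t => 4 * Λ - 2 * (d - c) * p t).intervalIntegrable _ _)
      ((hinv.const_mul _).intervalIntegrable _ _),
      intervalIntegral.integral_sub (by simp)
      ((by fun_prop : Continuous fun t => 2 * (d - c) * p t).intervalIntegrable _ _),
      intervalIntegral.integral_const_mul (2 * (d - c)) p,
      intervalIntegral.integral_const_mul (2 * (d - c)) fun t => 2 / p t, hI1]
    simp only [intervalIntegral.integral_const, smul_eq_mul, ← hΛ]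
    ring
  have hIα : I α = 0 := by
    by_contra hne
    have hpos : 0 < I α := lt_of_le_of_ne (hI0 α ⟨hα.1.le, hα.2.le⟩) (Ne.symm hne)
    refine (intervalIntegral.integral_pos hcd (hIc.mul hinv).continuousOn
      (fun β hβ => mul_nonneg (hI0 β ⟨hβ.1.le, hβ.2⟩) (div_nonneg zero_le_two (h.pos β).le))
      ⟨α, ⟨hα.1.le, hα.2.le⟩, mul_pos hpos (div_pos two_pos (h.pos α))⟩).ne' hzero
  have h2 : ∫ t in α..d, (r t + Real.tan (t - d) * (p t - p α)) ^ 2 = 0 := by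
    have := hsplit α hα
    linarith [(hnn α hα).1, (hnn α hα).2]
  -- At $t=\alpha$ the tangent term drops out and the integrand is $r(\alpha)^2$.
  by_contra hne
  refine (intervalIntegral.integral_pos hα.2 ?_ (fun t _ => sq_nonneg _)
    ⟨α, ⟨le_rfl, hα.2.le⟩, by simpa using pow_pos (abs_pos.mpr hne) 2⟩).ne' h2
  have htan : ContinuousOn (fun t => Real.tan (t - d)) (Icc α d) := fun t ht =>
    ((Real.continuousAt_tan.mpr (Real.cos_pos_of_mem_Ioo
      ⟨by linarith [ht.1, hα.1], by linarith [ht.2, Real.pi_pos]⟩).ne').comp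
      (f := fun t => t - d) (by fun_prop)).continuousWithinAt
  exact (hrc.continuousOn.add (htan.mul (by fun_prop))).pow 2

/-- The only convex shrinker of turning number one is the circle of radius `√2`. -/
theorem eq_sqrt_two (h : IsSupportSolution p r) (hper : Function.Periodic p (2 * Real.pi))
    (t : ℝ) : p t = √2 := by
  obtain ⟨c, d, hcd, hlen, hc, hd⟩ : ∃ c d, c < d ∧ d - c ≤ Real.pi / 2 ∧ r c = 0 ∧ r d = 0 := by
    obtain ⟨c, -, hc⟩ := exists_hasDerivAt_eq_zero (f := p) (f' := r) Real.two_pi_pos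
      h.continuous.continuousOn (by simpa using (hper 0).symm) fun t _ => h.hasDerivAt t
    have hc' := h.critical_add_pi hper hc
    obtain ⟨a, ha, ha0⟩ := h.exists_critical_between hc hc'
    -- The point $a$ cuts an interval of length $\pi$ in two, so one of the pieces has length at
    -- most $\pi/2$.
    rcases le_total (a - c) (Real.pi / 2) with hle | hle
    · exact ⟨c, a, ha.1, hle, hc, ha0⟩
    · exact ⟨a, c + Real.pi, ha.2, by linarith, ha0, hc'⟩
  obtain ⟨m, hm⟩ := exists_between hcd
  have hev : r =ᶠ[nhds m] fun _ => 0 := by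
    filter_upwards [Ioo_mem_nhds hm.1 hm.2] with s hs using
      h.critical_of_mem_Ioo hcd hlen hc hd hs
  have h1 : 2 / p m - p m = 0 :=
    (h.hasDerivAt' m).unique ((hasDerivAt_const m (0 : ℝ)).congr_of_eventuallyEq hev)
  have hpm : p m = √2 := by
    have := h.pos m
    rw [sub_eq_zero, div_eq_iff this.ne'] at h1
    rw [eq_comm, Real.sqrt_eq_iff_mul_self_eq zero_le_two this.le]
    exact h1
  -- Uniqueness was proved forward only, so $t$ is moved beyond $m$ by a multiple of the period.
  obtain ⟨n, hn⟩ := exists_nat_gt ((m - t) / (2 * Real.pi))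
  rw [div_lt_iff₀ Real.two_pi_pos] at hn
  rw [← hper.nat_mul n t]
  exact h.eq_of_le const hpm hev.self_of_nhds (by linarith)

end IsSupportSolution

/-! ### The moving frame of a plane curve -/

/-- The rotation of the plane by a right angle. -/
noncomputable def planeRotation : EuclideanSpace ℝ (Fin 2) →L[ℝ] EuclideanSpace ℝ (Fin 2) :=
  LinearMap.toContinuousLinearMap
    { toFun := fun v => !₂[-v 1, v 0]
      map_add' := fun v w => by
        ext i
        fin_cases i <;> simp [add_comm]
      map_smul' := fun a v => by
        ext i
        fin_cases i <;> simp }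

section Plane

variable (v w z : EuclideanSpace ℝ (Fin 2))

theorem planeRotation_apply : planeRotation v = !₂[-v 1, v 0] := rfl

theorem inner_plane : ⟪v, w⟫ = v 0 * w 0 + v 1 * w 1 := by
  simp [PiLp.inner_apply, Fin.sum_univ_two, mul_comm]

theorem planeRotation_planeRotation : planeRotation (planeRotation v) = -v := by
  ext i
  fin_cases i <;> simp [planeRotation_apply]

theorem inner_planeRotation_planeRotation :
    ⟪planeRotation v, planeRotation w⟫ = ⟪v, w⟫ := by
  simp [inner_plane, planeRotation_apply, add_comm]

theorem inner_planeRotation_left : ⟪planeRotation v, w⟫ = -⟪v, planeRotation w⟫ := by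
  simp [inner_plane, planeRotation_apply]

theorem inner_self_planeRotation : ⟪v, planeRotation v⟫ = 0 := by
  simp [inner_plane, planeRotation_apply, mul_comm]

variable {v} in
theorem eq_add_planeRotation (hv : ⟪v, v⟫ = 1) :
    z = ⟪z, v⟫ • v + ⟪z, planeRotation v⟫ • planeRotation v := by
  rw [inner_plane] at hv
  ext i
  fin_cases i
  · simp [inner_plane, planeRotation_apply]
    linear_combination -z 0 * hv
  · simp [inner_plane, planeRotation_apply]
    linear_combination -z 1 * hv

end Plane

namespace ImmersedCurve

variable (γ : ImmersedCurve (EuclideanSpace ℝ (Fin 2)))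

/-- The speed of the parametrization. -/
noncomputable def speed (t : ℝ) : ℝ := ‖deriv γ t‖

/-- The unit normal vector field of a plane curve, obtained by rotating the unit tangent. -/
noncomputable def unitNormal (t : ℝ) : EuclideanSpace ℝ (Fin 2) := planeRotation (γ.tangent t)

/-- The signed curvature of a plane curve. -/
noncomputable def curvature (t : ℝ) : ℝ := ⟪γ.arcDeriv γ.tangent t, γ.unitNormal t⟫

/-- The tangential component of the position vector. -/
noncomputable def radial (t : ℝ) : ℝ := ⟪γ t, γ.tangent t⟫

theorem speed_pos (t : ℝ) : 0 < γ.speed t := norm_pos_iff.mpr (γ.regular t)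

theorem contDiff_deriv : ContDiff ℝ ∞ (deriv γ) := (contDiff_infty_iff_deriv.mp γ.smooth).2

theorem contDiff_speed : ContDiff ℝ ∞ γ.speed := γ.contDiff_deriv.norm ℝ γ.regular

theorem continuous_speed : Continuous γ.speed := γ.contDiff_speed.continuous

theorem contDiff_tangent : ContDiff ℝ ∞ γ.tangent :=
  (γ.contDiff_speed.inv fun t => (γ.speed_pos t).ne').smul γ.contDiff_deriv

theorem contDiff_unitNormal : ContDiff ℝ ∞ γ.unitNormal :=
  planeRotation.contDiff.comp γ.contDiff_tangent

theorem contDiff_curvature : ContDiff ℝ ∞ γ.curvature :=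
  ((γ.contDiff_speed.inv fun t => (γ.speed_pos t).ne').smul
    (contDiff_infty_iff_deriv.mp γ.contDiff_tangent).2).inner ℝ γ.contDiff_unitNormal

theorem continuous_curvature : Continuous γ.curvature := γ.contDiff_curvature.continuous

theorem deriv_eq_speed_smul (t : ℝ) : deriv γ t = γ.speed t • γ.tangent t := by
  rw [tangent, arcDeriv, ← speed, smul_inv_smul₀ (γ.speed_pos t).ne']

theorem hasDerivAt_toFun (t : ℝ) : HasDerivAt γ (γ.speed t • γ.tangent t) t := by
  rw [← deriv_eq_speed_smul]
  exact ((γ.smooth.differentiable (by simp)) t).hasDerivAt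

theorem inner_tangent_self (t : ℝ) : ⟪γ.tangent t, γ.tangent t⟫ = 1 := by
  have : ‖γ.tangent t‖ = 1 := by
    simp only [tangent, arcDeriv, norm_smul, norm_inv, norm_norm]
    exact inv_mul_cancel₀ (γ.speed_pos t).ne'
  rw [real_inner_self_eq_norm_sq, this, one_pow]

theorem inner_unitNormal_self (t : ℝ) : ⟪γ.unitNormal t, γ.unitNormal t⟫ = 1 := by
  rw [unitNormal, inner_planeRotation_planeRotation, inner_tangent_self]

theorem inner_tangent_unitNormal (t : ℝ) : ⟪γ.tangent t, γ.unitNormal t⟫ = 0 :=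
  inner_self_planeRotation _

theorem inner_unitNormal_tangent (t : ℝ) : ⟪γ.unitNormal t, γ.tangent t⟫ = 0 := by
  rw [real_inner_comm, inner_tangent_unitNormal]

theorem eq_tangent_add_unitNormal (t : ℝ) (z : EuclideanSpace ℝ (Fin 2)) :
    z = ⟪z, γ.tangent t⟫ • γ.tangent t + ⟪z, γ.unitNormal t⟫ • γ.unitNormal t :=
  eq_add_planeRotation z (γ.inner_tangent_self t)

theorem normalPart_eq (u : ℝ → EuclideanSpace ℝ (Fin 2)) (t : ℝ) :
    γ.normalPart u t = ⟪u t, γ.unitNormal t⟫ • γ.unitNormal t := by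
  rw [normalPart, sub_eq_iff_eq_add', ← eq_tangent_add_unitNormal]

theorem hasDerivAt_tangent (t : ℝ) :
    HasDerivAt γ.tangent ((γ.speed t * γ.curvature t) • γ.unitNormal t) t := by
  have h := ((γ.contDiff_tangent.differentiable (by simp)) t).hasDerivAt
  refine h.congr_deriv ?_
  have h2 : HasDerivAt (fun s => ⟪γ.tangent s, γ.tangent s⟫)
      (⟪γ.tangent t, deriv γ.tangent t⟫ + ⟪deriv γ.tangent t, γ.tangent t⟫) t := h.inner ℝ h
  simp only [inner_tangent_self] at h2
  have h3 := h2.unique (hasDerivAt_const t (1 : ℝ))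
  rw [real_inner_comm, ← two_mul, mul_eq_zero, or_iff_right two_ne_zero] at h3
  rw [γ.eq_tangent_add_unitNormal t (deriv γ.tangent t), h3, zero_smul, zero_add, curvature,
    arcDeriv, real_inner_smul_left, ← speed, mul_inv_cancel_left₀ (γ.speed_pos t).ne']

theorem hasDerivAt_unitNormal (t : ℝ) :
    HasDerivAt γ.unitNormal (-(γ.speed t * γ.curvature t) • γ.tangent t) t := by
  refine HasDerivAt.congr_deriv (planeRotation.hasFDerivAt.comp_hasDerivAt t
    (γ.hasDerivAt_tangent t)) ?_
  rw [map_smul, unitNormal, planeRotation_planeRotation, smul_neg, neg_smul]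

theorem meanCurvature_eq (t : ℝ) : γ.meanCurvature t = γ.curvature t • γ.unitNormal t := by
  rw [meanCurvature, normalDeriv, normalPart_eq, curvature]

theorem normalDeriv_smul_unitNormal {f f' : ℝ → ℝ} (hf : ∀ t, HasDerivAt f (f' t) t) :
    γ.normalDeriv (fun t => f t • γ.unitNormal t) =
      fun t => ((γ.speed t)⁻¹ * f' t) • γ.unitNormal t := by
  funext t
  rw [normalDeriv, normalPart_eq]
  congr 1
  have h : HasDerivAt (fun t => f t • γ.unitNormal t) _ t := (hf t).smul (γ.hasDerivAt_unitNormal t)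
  rw [arcDeriv, h.deriv]
  simp only [inner_add_left, real_inner_smul_left, inner_tangent_unitNormal,
    inner_unitNormal_self, speed]
  ring

/-! ### Periodicity -/

theorem periodic_deriv : Function.Periodic (deriv γ) γ.period := fun t => by
  rw [← deriv_comp_add_const]
  exact congrArg (deriv · t) (funext γ.periodic)

theorem periodic_speed : Function.Periodic γ.speed γ.period := fun t => by
  simp only [speed, γ.periodic_deriv t]

theorem periodic_tangent : Function.Periodic γ.tangent γ.period := fun t => by
  simp only [tangent, arcDeriv, γ.periodic_deriv t]

theorem periodic_unitNormal : Function.Periodic γ.unitNormal γ.period := fun t => by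
  simp only [unitNormal, γ.periodic_tangent t]

theorem periodic_curvature : Function.Periodic γ.curvature γ.period := fun t => by
  have h : deriv γ.tangent (t + γ.period) = deriv γ.tangent t := by
    rw [← deriv_comp_add_const]
    exact congrArg (deriv · t) (funext γ.periodic_tangent)
  simp only [curvature, arcDeriv, γ.periodic_deriv t, h, γ.periodic_unitNormal t]

/-! ### The tangent angle -/

/-- The angle by which the tangent has turned since the parameter value `0`. -/
noncomputable def angle (t : ℝ) : ℝ := ∫ s in (0 : ℝ)..t, γ.speed s * γ.curvature s

theorem angle_zero : γ.angle 0 = 0 := intervalIntegral.integral_same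

theorem hasDerivAt_angle (t : ℝ) : HasDerivAt γ.angle (γ.speed t * γ.curvature t) t :=
  have hc : Continuous fun s => γ.speed s * γ.curvature s :=
    γ.continuous_speed.mul γ.continuous_curvature
  intervalIntegral.integral_hasDerivAt_right (hc.intervalIntegrable _ _)
    (hc.stronglyMeasurableAtFilter _ _) hc.continuousAt

theorem continuous_angle : Continuous γ.angle :=
  continuous_iff_continuousAt.mpr fun t => (γ.hasDerivAt_angle t).continuousAt

theorem contDiff_angle : ContDiff ℝ ∞ γ.angle := by
  refine contDiff_infty_iff_deriv.mpr ⟨fun t => (γ.hasDerivAt_angle t).differentiableAt, ?_⟩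
  rw [show deriv γ.angle = fun t => γ.speed t * γ.curvature t from
    funext fun t => (γ.hasDerivAt_angle t).deriv]
  exact γ.contDiff_speed.mul γ.contDiff_curvature

theorem angle_add_period (t : ℝ) : γ.angle (t + γ.period) = γ.angle t + γ.angle γ.period := by
  have hd : ∀ s, HasDerivAt (fun s => γ.angle (s + γ.period) - γ.angle s) 0 s := fun s => by
    refine (((γ.hasDerivAt_angle _).comp_add_const s γ.period).sub
      (γ.hasDerivAt_angle s)).congr_deriv ?_
    rw [γ.periodic_speed, γ.periodic_curvature, sub_self]
  have h := is_const_of_deriv_eq_zero (fun s => (hd s).differentiableAt) (fun s => (hd s).deriv) t 0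
  simp only [zero_add, angle_zero] at h
  linarith

/-- The coordinates of $T$ in the initial frame rotate with angular velocity $\theta'$. Rotating
them back by $\theta$ gives constants, which equal $(1,0)$ at the parameter $0$. -/
theorem inner_tangent_zero (t : ℝ) :
    ⟪γ.tangent t, γ.tangent 0⟫ = Real.cos (γ.angle t) ∧
      ⟪γ.tangent t, γ.unitNormal 0⟫ = Real.sin (γ.angle t) := by
  set a : ℝ → ℝ := fun t => ⟪γ.tangent t, γ.tangent 0⟫ with ha
  set b : ℝ → ℝ := fun t => ⟪γ.tangent t, γ.unitNormal 0⟫ with hb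
  have hda : ∀ t, HasDerivAt a (-(γ.speed t * γ.curvature t * b t)) t := fun t => by
    refine HasDerivAt.congr_deriv ((γ.hasDerivAt_tangent t).inner ℝ
      (hasDerivAt_const t (γ.tangent 0))) ?_
    rw [inner_zero_right, zero_add, real_inner_smul_left, unitNormal, inner_planeRotation_left,
      hb, unitNormal, mul_neg]
  have hdb : ∀ t, HasDerivAt b (γ.speed t * γ.curvature t * a t) t := fun t => by
    refine HasDerivAt.congr_deriv ((γ.hasDerivAt_tangent t).inner ℝ
      (hasDerivAt_const t (γ.unitNormal 0))) ?_
    rw [inner_zero_right, zero_add, real_inner_smul_left, unitNormal, unitNormal,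
      inner_planeRotation_planeRotation]
  have hcos : ∀ t, HasDerivAt (fun t => Real.cos (γ.angle t)) _ t := fun t =>
    (γ.hasDerivAt_angle t).cos
  have hsin : ∀ t, HasDerivAt (fun t => Real.sin (γ.angle t)) _ t := fun t =>
    (γ.hasDerivAt_angle t).sin
  have h1 : ∀ t, HasDerivAt
      (fun t => a t * Real.cos (γ.angle t) + b t * Real.sin (γ.angle t)) 0 t := fun t =>
    (((hda t).mul (hcos t)).add ((hdb t).mul (hsin t))).congr_deriv (by ring)
  have h2 : ∀ t, HasDerivAt
      (fun t => b t * Real.cos (γ.angle t) - a t * Real.sin (γ.angle t)) 0 t := fun t =>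
    (((hdb t).mul (hcos t)).sub ((hda t).mul (hsin t))).congr_deriv (by ring)
  have e1 := is_const_of_deriv_eq_zero (fun s => (h1 s).differentiableAt)
    (fun s => (h1 s).deriv) t 0
  have e2 := is_const_of_deriv_eq_zero (fun s => (h2 s).differentiableAt)
    (fun s => (h2 s).deriv) t 0
  have ha0 : a 0 = 1 := γ.inner_tangent_self 0
  have hb0 : b 0 = 0 := γ.inner_tangent_unitNormal 0
  simp only [angle_zero, Real.cos_zero, Real.sin_zero, ha0, hb0] at e1 e2
  have h3 := Real.sin_sq_add_cos_sq (γ.angle t)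
  constructor
  · linear_combination Real.cos (γ.angle t) * e1 - Real.sin (γ.angle t) * e2 - a t * h3
  · linear_combination Real.sin (γ.angle t) * e1 + Real.cos (γ.angle t) * e2 - b t * h3

theorem exists_angle_period : ∃ m : ℤ, γ.angle γ.period = m * (2 * Real.pi) := by
  have h : γ.tangent γ.period = γ.tangent 0 := by simpa using γ.periodic_tangent 0
  have h1 : Real.cos (γ.angle γ.period) = 1 := by
    rw [← (γ.inner_tangent_zero _).1, h, inner_tangent_self]
  obtain ⟨m, hm⟩ := (Real.cos_eq_one_iff _).mp h1
  exact ⟨m, hm.symm⟩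

theorem tangent_eq_iff (s t : ℝ) :
    γ.tangent s = γ.tangent t ↔ ∃ n : ℤ, n * (2 * Real.pi) = γ.angle s - γ.angle t := by
  rw [← Real.cos_eq_one_iff, Real.cos_sub]
  have hs := γ.eq_tangent_add_unitNormal 0 (γ.tangent s)
  have ht := γ.eq_tangent_add_unitNormal 0 (γ.tangent t)
  rw [(γ.inner_tangent_zero s).1, (γ.inner_tangent_zero s).2] at hs
  rw [(γ.inner_tangent_zero t).1, (γ.inner_tangent_zero t).2] at ht
  have h1 := Real.sin_sq_add_cos_sq (γ.angle s)
  have h2 := Real.sin_sq_add_cos_sq (γ.angle t)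
  constructor
  · intro h
    rw [← (γ.inner_tangent_zero s).1, ← (γ.inner_tangent_zero s).2, h,
      (γ.inner_tangent_zero t).1, (γ.inner_tangent_zero t).2]
    linear_combination h2
  · intro h
    -- The squared distance between the two points of the unit circle is
    -- $2-2\cos(\theta_s-\theta_t)=0$.
    have e1 : Real.cos (γ.angle s) = Real.cos (γ.angle t) := by
      nlinarith [sq_nonneg (Real.cos (γ.angle s) - Real.cos (γ.angle t)),
        sq_nonneg (Real.sin (γ.angle s) - Real.sin (γ.angle t))]
    have e2 : Real.sin (γ.angle s) = Real.sin (γ.angle t) := by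
      nlinarith [sq_nonneg (Real.cos (γ.angle s) - Real.cos (γ.angle t)),
        sq_nonneg (Real.sin (γ.angle s) - Real.sin (γ.angle t))]
    rw [hs, ht, e1, e2]

/-! ### Shrinkers -/

section Shrinker

variable {γ}

theorem IsShrinker.curvature_eq (h : γ.IsShrinker) (t : ℝ) :
    γ.curvature t = -(⟪γ t, γ.unitNormal t⟫ / 2) := by
  have h1 := congrArg (⟪·, γ.unitNormal t⟫) (h t)
  simp only [meanCurvature_eq, normalPart_eq, inner_neg_left, real_inner_smul_left,
    inner_unitNormal_self] at h1
  linarith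

theorem IsShrinker.inner_unitNormal (h : γ.IsShrinker) (t : ℝ) :
    ⟪γ t, γ.unitNormal t⟫ = -(2 * γ.curvature t) := by
  rw [h.curvature_eq]
  ring

theorem IsShrinker.toFun_eq (h : γ.IsShrinker) (t : ℝ) :
    γ t = γ.radial t • γ.tangent t + (-(2 * γ.curvature t)) • γ.unitNormal t := by
  rw [← h.inner_unitNormal]
  exact γ.eq_tangent_add_unitNormal t (γ t)

theorem IsShrinker.norm_sq (h : γ.IsShrinker) (t : ℝ) :
    ‖γ t‖ ^ 2 = γ.radial t ^ 2 + 4 * γ.curvature t ^ 2 := by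
  rw [← real_inner_self_eq_norm_sq, h.toFun_eq t]
  simp only [inner_add_left, inner_add_right, real_inner_smul_left, real_inner_smul_right,
    inner_tangent_unitNormal, inner_unitNormal_tangent, inner_tangent_self, inner_unitNormal_self]
  ring

/-- Differentiating $\kappa=-\tfrac12\langle x,N\rangle$ with $N_s=-\kappa T$ lowers the order: the
shrinker equation becomes a first order system for $\kappa$ and $\langle x,T\rangle$. -/
theorem IsShrinker.hasDerivAt_curvature (h : γ.IsShrinker) (t : ℝ) :
    HasDerivAt γ.curvature (γ.speed t * (γ.curvature t * γ.radial t / 2)) t := by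
  rw [show γ.curvature = fun t => -(⟪γ t, γ.unitNormal t⟫ / 2) from funext h.curvature_eq]
  refine (((γ.hasDerivAt_toFun t).inner ℝ (γ.hasDerivAt_unitNormal t)).div_const
    2).neg.congr_deriv ?_
  simp only [real_inner_smul_left, real_inner_smul_right, inner_tangent_unitNormal,
    ← h.curvature_eq t, radial]
  ring

theorem IsShrinker.hasDerivAt_radial (h : γ.IsShrinker) (t : ℝ) :
    HasDerivAt γ.radial (γ.speed t * (1 - 2 * γ.curvature t ^ 2)) t := by
  refine ((γ.hasDerivAt_toFun t).inner ℝ (γ.hasDerivAt_tangent t)).congr_deriv ?_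
  simp only [real_inner_smul_left, real_inner_smul_right, inner_tangent_self, h.inner_unitNormal]
  ring

/-- On a shrinker the curvature is a constant multiple of `e^{|x|² / 4}`. -/
theorem IsShrinker.exists_curvature_mul_exp (h : γ.IsShrinker) :
    ∃ C, ∀ t, γ.curvature t * Real.exp (-(‖γ t‖ ^ 2 / 4)) = C := by
  have hn : ∀ t, HasDerivAt (fun t => ‖γ t‖ ^ 2) (2 * (γ.speed t * γ.radial t)) t := fun t => by
    refine HasDerivAt.congr_deriv (γ.hasDerivAt_toFun t).norm_sq ?_
    rw [real_inner_smul_right, radial]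
  -- The logarithmic rate $\tfrac12\langle x,T\rangle$ of $\kappa$ equals the derivative of
  -- $|x|^2/4$ in arc length, so the two cancel.
  have hd : ∀ t, HasDerivAt (fun t => γ.curvature t * Real.exp (-(‖γ t‖ ^ 2 / 4))) 0 t := fun t =>
    ((h.hasDerivAt_curvature t).mul ((hn t).div_const 4).neg.exp).congr_deriv (by ring)
  exact ⟨_, fun t => is_const_of_deriv_eq_zero (fun s => (hd s).differentiableAt)
    (fun s => (hd s).deriv) t 0⟩

/-- The stability operator on a normal field whose length depends on the tangent angle only. -/
theorem IsShrinker.stabilityOperator_angle (h : γ.IsShrinker) {F F' F'' : ℝ → ℝ}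
    (hF : ∀ y, HasDerivAt F (F' y) y) (hF' : ∀ y, HasDerivAt F' (F'' y) y) (t : ℝ) :
    γ.stabilityOperator (fun t => F (γ.angle t) • γ.unitNormal t) t =
      (γ.curvature t ^ 2 * (F'' (γ.angle t) + F (γ.angle t)) + F (γ.angle t) / 2) •
        γ.unitNormal t := by
  have h1 : γ.normalDeriv (fun t => F (γ.angle t) • γ.unitNormal t) =
      fun t => (F' (γ.angle t) * γ.curvature t) • γ.unitNormal t := by
    refine (γ.normalDeriv_smul_unitNormal (f := fun t => F (γ.angle t))
      fun t => (hF _).comp t (γ.hasDerivAt_angle t)).trans ?_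
    funext t
    have := (γ.speed_pos t).ne'
    congr 1
    field_simp
  have h2 := γ.normalDeriv_smul_unitNormal fun t =>
    ((hF' _).comp t (γ.hasDerivAt_angle t)).mul (h.hasDerivAt_curvature t)
  simp only [Function.comp_apply, Pi.mul_apply, Function.comp_def] at h2
  -- The term $\tfrac12F'\kappa\langle x,T\rangle$ coming from the derivative of $\kappa$ cancels
  -- the drift term, leaving $\kappa^2F''$.
  simp only [stabilityOperator, driftLaplacian, h1, h2, meanCurvature_eq, real_inner_smul_left,
    real_inner_smul_right, inner_unitNormal_self, smul_smul, ← add_smul, ← sub_smul]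
  congr 1
  have := (γ.speed_pos t).ne'
  simp only [radial]
  field_simp
  ring

end Shrinker

end ImmersedCurve

/-! ### Completeness, finite entropy and the reduction to closed curves -/

/-- A function on the line whose derivative has infinite integral near both ends is surjective. -/
theorem surjective_of_lintegral_deriv_eq_top {f v : ℝ → ℝ} (hf : ∀ t, HasDerivAt f (v t) t)
    (hv : Continuous v) (hpos : ∀ t, 0 < v t) (h1 : ∫⁻ t in Ici (0 : ℝ), ‖v t‖ₑ = ⊤)
    (h2 : ∫⁻ t in Iic (0 : ℝ), ‖v t‖ₑ = ⊤) : Function.Surjective f := by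
  have hfc : Continuous f := continuous_iff_continuousAt.mpr fun t => (hf t).continuousAt
  have hint : ∀ a b, ∫ t in a..b, ‖v t‖ = f b - f a := fun a b => by
    rw [← intervalIntegral.integral_eq_sub_of_hasDerivAt (fun t _ => hf t)
      (hv.intervalIntegrable _ _)]
    exact intervalIntegral.integral_congr fun t _ => Real.norm_of_nonneg (hpos t).le
  intro y
  refine mem_range_of_exists_le_of_exists_ge hfc ?_ ?_
  · by_contra! hcon
    have h := integrableOn_Iic_of_intervalIntegral_norm_bounded (f := v) (μ := volume)
      (l := Filter.atTop) (a := fun n : ℕ => -(n : ℝ)) (f 0 - y) 0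
      (fun i => (hv.integrableOn_Icc (a := -(i : ℝ)) (b := 0)).mono_set Ioc_subset_Icc_self)
      (Filter.tendsto_neg_atTop_atBot.comp tendsto_natCast_atTop_atTop)
      (Filter.Eventually.of_forall fun i => by
        rw [hint]
        linarith [hcon (-(i : ℝ))])
    exact h.2.ne h2
  · by_contra! hcon
    have h := integrableOn_Ioi_of_intervalIntegral_norm_bounded (f := v) (μ := volume)
      (l := Filter.atTop) (b := fun n : ℕ => (n : ℝ)) (y - f 0) 0
      (fun i => (hv.integrableOn_Icc (a := 0) (b := (i : ℝ))).mono_set Ioc_subset_Icc_self)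
      tendsto_natCast_atTop_atTop
      (Filter.Eventually.of_forall fun i => by
        rw [hint]
        linarith [hcon (i : ℝ)])
    rw [← integrableOn_Ici_iff_integrableOn_Ioi] at h
    exact h.2.ne h1

/-- Finitely many orthogonality conditions can be met by a nontrivial combination of a larger number
of continuous functions. -/
theorem exists_ne_zero_integral_sum_mul_eq_zero {m n : ℕ} (hmn : m < n) {e : Fin n → ℝ → ℝ}
    {g : Fin m → ℝ → ℝ} (he : ∀ i, Continuous (e i)) (hg : ∀ j, Continuous (g j)) (a b : ℝ) :
    ∃ x : Fin n → ℝ, x ≠ 0 ∧ ∀ j, ∫ t in a..b, (∑ i, x i * e i t) * g j t = 0 := by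
  set M : Matrix (Fin m) (Fin n) ℝ := fun j i => ∫ t in a..b, e i t * g j t with hM
  have hker : LinearMap.ker M.mulVecLin ≠ ⊥ := LinearMap.ker_ne_bot_of_finrank_lt (by simpa)
  obtain ⟨x, hx, hx0⟩ := Submodule.exists_mem_ne_zero_of_ne_bot hker
  refine ⟨x, hx0, fun j => ?_⟩
  have hj : ∑ i, (∫ t in a..b, e i t * g j t) * x i = 0 := congrFun (LinearMap.mem_ker.mp hx) j
  have hc : ∀ i, Continuous fun t => x i * e i t * g j t := fun i =>
    (continuous_const.mul (he i)).mul (hg j)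
  refine Eq.trans ?_ hj
  simp_rw [Finset.sum_mul]
  rw [intervalIntegral.integral_finsetSum fun i _ => (hc i).intervalIntegrable _ _]
  refine Finset.sum_congr rfl fun i _ => ?_
  simp_rw [mul_assoc]
  rw [intervalIntegral.integral_const_mul, mul_comm]

namespace ImmersedCurve

variable {γ : ImmersedCurve (EuclideanSpace ℝ (Fin 2))}

theorem domain_of_period_eq_zero (h : γ.period = 0) : γ.domain = univ := if_pos h

theorem domain_of_period_pos (h : 0 < γ.period) : γ.domain = Ico 0 γ.period := if_neg h.ne'

theorem gaussianIntegral_of_period_pos (h : 0 < γ.period) (g : ℝ → ℝ) :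
    γ.gaussianIntegral g = (√(4 * Real.pi))⁻¹ *
      ∫ t in (0 : ℝ)..γ.period, g t * (Real.exp (-(‖γ t‖ ^ 2 / 4)) * γ.speed t) := by
  rw [gaussianIntegral, domain_of_period_pos h, intervalIntegral.integral_of_le h.le,
    integral_Ico_eq_integral_Ioc]
  simp only [mul_assoc, speed]

theorem enorm_speed (t : ℝ) : ‖γ.speed t‖ₑ = ‖deriv γ t‖ₑ := enorm_norm _

/-- A flat complete shrinker is a line through the origin. -/
theorem IsShrinker.line_of_curvature_eq_zero (h : γ.IsShrinker) (hcomplete : γ.IsComplete)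
    (hκ : ∀ t, γ.curvature t = 0) :
    Set.InjOn γ γ.domain ∧ ∃ ℓ : Submodule ℝ (EuclideanSpace ℝ (Fin 2)),
      Module.finrank ℝ ℓ = 1 ∧ Set.range γ = (ℓ : Set (EuclideanSpace ℝ (Fin 2))) := by
  have hT : ∀ t, γ.tangent t = γ.tangent 0 := fun t =>
    is_const_of_deriv_eq_zero (γ.contDiff_tangent.differentiable (by simp))
      (fun s => by rw [(γ.hasDerivAt_tangent s).deriv, hκ, mul_zero, zero_smul]) t 0
  have hγ : ∀ t, γ t = γ.radial t • γ.tangent 0 := fun t => by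
    rw [h.toFun_eq t, hκ, hT t, mul_zero, neg_zero, zero_smul, add_zero]
  have hq : ∀ t, HasDerivAt γ.radial (γ.speed t) t := fun t =>
    (h.hasDerivAt_radial t).congr_deriv (by rw [hκ]; ring)
  have hmono : StrictMono γ.radial := strictMono_of_deriv_pos fun t => by
    rw [(hq t).deriv]
    exact γ.speed_pos t
  have hinj : Function.Injective γ := fun s t hst => hmono.injective (by
    rw [radial, radial, hst, hT s, hT t])
  have hper : γ.period = 0 := hinj (by simpa using γ.periodic 0)
  obtain ⟨c1, c2⟩ := hcomplete hper
  have hsurj := surjective_of_lintegral_deriv_eq_top hq γ.continuous_speed γ.speed_pos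
    (by simpa only [enorm_speed] using c1) (by simpa only [enorm_speed] using c2)
  have hT0 : γ.tangent 0 ≠ 0 := fun h0 => by
    have := γ.inner_tangent_self 0
    simp [h0] at this
  refine ⟨hinj.injOn, Submodule.span ℝ {γ.tangent 0}, finrank_span_singleton hT0, ?_⟩
  ext z
  rw [SetLike.mem_coe, Submodule.mem_span_singleton]
  constructor
  · rintro ⟨t, rfl⟩
    exact ⟨γ.radial t, (hγ t).symm⟩
  · rintro ⟨a, rfl⟩
    obtain ⟨t, rfl⟩ := hsurj a
    exact ⟨t, hγ t⟩

/-- A shrinker that is not flat is bounded, hence closed if it is complete with finite entropy. -/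
theorem IsShrinker.period_pos (h : γ.IsShrinker) (hcomplete : γ.IsComplete)
    (hentropy : γ.entropy < ⊤) {C : ℝ} (hC0 : C ≠ 0)
    (hC : ∀ t, γ.curvature t * Real.exp (-(‖γ t‖ ^ 2 / 4)) = C) : 0 < γ.period := by
  refine lt_of_le_of_ne γ.period_nonneg fun hper => ?_
  -- With $y=|x|^2/4$ the first integral reads $C^2e^{2y}=\kappa^2\le y\le e^y$.
  have hbound : ∀ t, C ^ 2 ≤ Real.exp (-(‖γ t‖ ^ 2 / 4)) := fun t => by
    set y := ‖γ t‖ ^ 2 / 4 with hy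
    have h1 : γ.curvature t ^ 2 ≤ y := by
      have := h.norm_sq t
      have := sq_nonneg (γ.radial t)
      linarith
    have h2 : y ≤ Real.exp y := by linarith [Real.add_one_le_exp y]
    have h3 : Real.exp y * Real.exp (-y) = 1 := by rw [← Real.exp_add]; simp
    calc C ^ 2 = γ.curvature t ^ 2 * Real.exp (-y) * Real.exp (-y) := by rw [← hC t]; ring
      _ ≤ Real.exp y * Real.exp (-y) * Real.exp (-y) := by gcongr; linarith
      _ = Real.exp (-y) := by rw [h3, one_mul]
  have hlen : ∫⁻ t, ENNReal.ofReal (C ^ 2) * ‖deriv γ t‖ₑ = ⊤ := by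
    rw [lintegral_const_mul' _ _ ENNReal.ofReal_ne_top]
    have h1 : ∫⁻ t, ‖deriv γ t‖ₑ = ⊤ :=
      top_le_iff.mp ((hcomplete hper.symm).1 ▸ setLIntegral_le_lintegral _ _)
    rw [h1, ENNReal.mul_top]
    simpa using hC0
  have hF : (γ.dilateTranslate 1 one_pos 0).gaussianLength = ⊤ := by
    have hfun : (γ.dilateTranslate 1 one_pos 0).toFun = γ.toFun :=
      funext fun t => by simp [dilateTranslate]
    rw [gaussianLength, hfun, domain_of_period_eq_zero (by exact hper.symm), setLIntegral_univ]
    have h1 : ∫⁻ t, ENNReal.ofReal (Real.exp (-(‖γ t‖ ^ 2 / 4)) * ‖deriv γ t‖) = ⊤ := by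
      refine top_le_iff.mp (hlen ▸ lintegral_mono fun t => ?_)
      rw [ENNReal.ofReal_mul (Real.exp_pos _).le, ofReal_norm]
      gcongr
      exact hbound t
    rw [h1, ENNReal.mul_top]
    simpa using Real.pi_pos
  refine hentropy.ne (top_le_iff.mp ?_)
  rw [← hF]
  exact le_iSup_of_le 1 (le_iSup_of_le one_pos (le_iSup_of_le 0 le_rfl))

/-- The tangent of a curve of nonvanishing turning number takes all directions. -/
theorem surjective_angle (h : γ.angle γ.period ≠ 0) : Function.Surjective γ.angle := by
  have hn : ∀ n : ℕ, γ.angle (n * γ.period) = n * γ.angle γ.period := fun n => by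
    induction n with
    | zero => simp [angle_zero]
    | succ n ih =>
      push_cast
      rw [add_mul, one_mul, angle_add_period, ih]
      ring
  have hneg : ∀ n : ℕ, γ.angle (-(n * γ.period)) = -(n * γ.angle γ.period) := fun n => by
    induction n with
    | zero => simp [angle_zero]
    | succ n ih =>
      have := γ.angle_add_period (-((n + 1 : ℕ) * γ.period))
      rw [show -((n + 1 : ℕ) * γ.period) + γ.period = -(n * γ.period) by push_cast; ring, ih] at this
      push_cast at this ⊢
      linarith
  intro y
  obtain ⟨n, hy⟩ := exists_nat_ge (|y| / |γ.angle γ.period|)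
  rw [div_le_iff₀ (abs_pos.mpr h), ← Nat.abs_cast n, ← abs_mul] at hy
  have h1 := abs_le.mp hy
  rcases abs_cases (n * γ.angle γ.period) with h2 | h2
  · exact mem_range_of_exists_le_of_exists_ge γ.continuous_angle
      ⟨_, (hneg n).le.trans (by linarith)⟩ ⟨_, le_trans (by linarith) (hn n).ge⟩
  · exact mem_range_of_exists_le_of_exists_ge γ.continuous_angle
      ⟨_, (hn n).le.trans (by linarith)⟩ ⟨_, le_trans (by linarith) (hneg n).ge⟩

/-! ### Stability and the turning number -/

/-- The second variation of a closed shrinker on a field whose length depends on the angle only. -/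
theorem IsShrinker.secondVariation_angle (h : γ.IsShrinker) (hper : 0 < γ.period)
    {F F' F'' : ℝ → ℝ} (hF : ∀ y, HasDerivAt F (F' y) y) (hF' : ∀ y, HasDerivAt F' (F'' y) y) :
    γ.secondVariation (fun t => F (γ.angle t) • γ.unitNormal t) = -((√(4 * Real.pi))⁻¹ *
      ∫ t in (0 : ℝ)..γ.period, F (γ.angle t) *
        (γ.curvature t ^ 2 * (F'' (γ.angle t) + F (γ.angle t)) + F (γ.angle t) / 2) *
        (Real.exp (-(‖γ t‖ ^ 2 / 4)) * γ.speed t)) := by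
  rw [secondVariation, gaussianIntegral_of_period_pos hper]
  simp only [h.stabilityOperator_angle hF hF', real_inner_smul_left, real_inner_smul_right,
    inner_unitNormal_self, mul_one]
  congr 3
  funext t
  ring

/-- Stability in terms of functions of the tangent angle. -/
theorem IsShrinker.integral_nonpos_of_isFStable (h : γ.IsShrinker) (hstable : γ.IsFStable)
    (hper : 0 < γ.period) {F F' F'' : ℝ → ℝ} (hsmooth : ContDiff ℝ ∞ F)
    (hF : ∀ y, HasDerivAt F (F' y) y) (hF' : ∀ y, HasDerivAt F' (F'' y) y)
    (hperF : Function.Periodic F (γ.angle γ.period))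
    (h1 : ∫ t in (0 : ℝ)..γ.period, F (γ.angle t) *
      (γ.curvature t * (Real.exp (-(‖γ t‖ ^ 2 / 4)) * γ.speed t)) = 0)
    (h2 : ∫ t in (0 : ℝ)..γ.period, F (γ.angle t) *
      (⟪γ.tangent 0, γ.unitNormal t⟫ * (Real.exp (-(‖γ t‖ ^ 2 / 4)) * γ.speed t)) = 0)
    (h3 : ∫ t in (0 : ℝ)..γ.period, F (γ.angle t) *
      (⟪γ.unitNormal 0, γ.unitNormal t⟫ * (Real.exp (-(‖γ t‖ ^ 2 / 4)) * γ.speed t)) = 0) :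
    ∫ t in (0 : ℝ)..γ.period, F (γ.angle t) *
      (γ.curvature t ^ 2 * (F'' (γ.angle t) + F (γ.angle t)) + F (γ.angle t) / 2) *
        (Real.exp (-(‖γ t‖ ^ 2 / 4)) * γ.speed t) ≤ 0 := by
  have hvar : γ.IsNormalVariation fun t => F (γ.angle t) • γ.unitNormal t :=
    { smooth := (hsmooth.comp γ.contDiff_angle).smul γ.contDiff_unitNormal
      periodic := fun t => by
        simp only [angle_add_period, hperF (γ.angle t), γ.periodic_unitNormal t]
      normal := fun t => by
        rw [deriv_eq_speed_smul, real_inner_smul_left, real_inner_smul_right,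
          inner_unitNormal_tangent, mul_zero, mul_zero]
      compactSupport := fun h0 => absurd h0 hper.ne' }
  have hγc : Continuous γ := γ.smooth.continuous
  have hspc := γ.continuous_speed
  have hNc := γ.contDiff_unitNormal.continuous
  have hFc := hsmooth.continuous
  have hac := γ.continuous_angle
  have key := hstable _ hvar ?_ fun V => ?_
  · rw [h.secondVariation_angle hper hF hF', Left.nonneg_neg_iff] at key
    exact nonpos_of_mul_nonpos_right key (by positivity)
  · rw [gaussianIntegral_of_period_pos hper]
    simp only [meanCurvature_eq, real_inner_smul_left, real_inner_smul_right,
      inner_unitNormal_self, mul_one]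
    refine Eq.trans ?_ ((congrArg ((√(4 * Real.pi))⁻¹ * ·) h1).trans (mul_zero _))
    congr 2
    funext t
    ring
  · rw [gaussianIntegral_of_period_pos hper]
    simp only [normalPart_eq, real_inner_smul_left, real_inner_smul_right,
      inner_unitNormal_self, mul_one]
    have hV : ∀ t, ⟪V, γ.unitNormal t⟫ * F (γ.angle t) *
        (Real.exp (-(‖γ t‖ ^ 2 / 4)) * γ.speed t) =
        ⟪V, γ.tangent 0⟫ * (F (γ.angle t) * (⟪γ.tangent 0, γ.unitNormal t⟫ *
          (Real.exp (-(‖γ t‖ ^ 2 / 4)) * γ.speed t))) +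
        ⟪V, γ.unitNormal 0⟫ * (F (γ.angle t) * (⟪γ.unitNormal 0, γ.unitNormal t⟫ *
          (Real.exp (-(‖γ t‖ ^ 2 / 4)) * γ.speed t))) := fun t => by
      have : ⟪V, γ.unitNormal t⟫ = ⟪V, γ.tangent 0⟫ * ⟪γ.tangent 0, γ.unitNormal t⟫ +
          ⟪V, γ.unitNormal 0⟫ * ⟪γ.unitNormal 0, γ.unitNormal t⟫ := by
        conv_lhs => rw [γ.eq_tangent_add_unitNormal 0 V]
        rw [inner_add_left, real_inner_smul_left, real_inner_smul_left]
      rw [this]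
      ring
    rw [intervalIntegral.integral_congr fun t _ => hV t, intervalIntegral.integral_add,
      intervalIntegral.integral_const_mul, intervalIntegral.integral_const_mul, h2, h3]
    · ring
    · exact Continuous.intervalIntegrable (by fun_prop) _ _
    · exact Continuous.intervalIntegrable (by fun_prop) _ _

/-- A closed shrinker of turning number other than `±1` is unstable. -/
theorem IsShrinker.sq_turning_lt (h : γ.IsShrinker) (hstable : γ.IsFStable)
    (hper : 0 < γ.period) {C : ℝ}
    (hC : ∀ t, γ.curvature t * Real.exp (-(‖γ t‖ ^ 2 / 4)) = C) {m : ℤ} (hm0 : m ≠ 0)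
    (hm : γ.angle γ.period = m * (2 * Real.pi)) : (m : ℝ) ^ 2 ≤ 1 := by
  by_contra! hm1
  have hμ : (m : ℝ) ≠ 0 := Int.cast_ne_zero.mpr hm0
  have hγc : Continuous γ := γ.smooth.continuous
  have hspc := γ.continuous_speed
  have hNc := γ.contDiff_unitNormal.continuous
  have hκc := γ.continuous_curvature
  have hac := γ.continuous_angle
  set W : ℝ → ℝ := fun t => Real.exp (-(‖γ t‖ ^ 2 / 4)) * γ.speed t with hW
  have hWc : Continuous W := by fun_prop
  have hWpos : ∀ t, 0 < W t := fun t => mul_pos (Real.exp_pos _) (γ.speed_pos t)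
  -- Four test functions against three conditions (the mean curvature and two translations). The
  -- slow modes $\cos(\theta/m),\sin(\theta/m)$ are well defined because $\theta$ turns by $2\pi m$.
  obtain ⟨x, hx0, hx⟩ := exists_ne_zero_integral_sum_mul_eq_zero (m := 3) (n := 4) (by norm_num)
    (e := ![fun _ => 1, fun t => Real.cos (γ.angle t / m), fun t => Real.sin (γ.angle t / m),
      fun t => Real.cos (γ.angle t)])
    (g := ![fun t => γ.curvature t * W t, fun t => ⟪γ.tangent 0, γ.unitNormal t⟫ * W t,
      fun t => ⟪γ.unitNormal 0, γ.unitNormal t⟫ * W t])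
    (fun i => by fin_cases i <;> simp <;> fun_prop) (fun j => by fin_cases j <;> simp <;> fun_prop)
    0 γ.period
  obtain ⟨a, b, c, d, rfl⟩ : ∃ a b c d, x = ![a, b, c, d] :=
    ⟨x 0, x 1, x 2, x 3, by ext i; fin_cases i <;> rfl⟩
  set A : ℝ → ℝ := fun y => b * Real.cos (y / m) + c * Real.sin (y / m) with hA
  set A' : ℝ → ℝ := fun y => (c * Real.cos (y / m) - b * Real.sin (y / m)) / m with hA'
  have hcosm : ∀ y, HasDerivAt (fun y => Real.cos (y / m)) (-Real.sin (y / m) * (1 / m)) y :=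
    fun y => ((hasDerivAt_id y).div_const _).cos
  have hsinm : ∀ y, HasDerivAt (fun y => Real.sin (y / m)) (Real.cos (y / m) * (1 / m)) y :=
    fun y => ((hasDerivAt_id y).div_const _).sin
  have hdA : ∀ y, HasDerivAt A (A' y) y := fun y =>
    (((hcosm y).const_mul b).add ((hsinm y).const_mul c)).congr_deriv (by simp only [hA']; ring)
  have hdA' : ∀ y, HasDerivAt A' (-(A y / m ^ 2)) y := fun y =>
    ((((hcosm y).const_mul c).sub ((hsinm y).const_mul b)).div_const _).congr_deriv
      (by simp only [hA]; ring)
  set F : ℝ → ℝ := fun y => a + A y + d * Real.cos y with hF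
  have hdF : ∀ y, HasDerivAt F (A' y - d * Real.sin y) y := fun y =>
    (((hdA y).const_add a).add ((Real.hasDerivAt_cos y).const_mul d)).congr_deriv (by ring)
  have hdF' : ∀ y, HasDerivAt (fun y => A' y - d * Real.sin y)
      (-(A y / m ^ 2) - d * Real.cos y) y := fun y =>
    (hdA' y).sub ((Real.hasDerivAt_sin y).const_mul d)
  have hsmooth : ContDiff ℝ ∞ F := by simp only [hF, hA]; fun_prop
  have hAper : ∀ y, (y + m * (2 * Real.pi)) / m = y / m + 2 * Real.pi := fun y => by
    field_simp
  have hperF : Function.Periodic F (γ.angle γ.period) := fun y => by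
    simp only [hF, hA, hm, hAper, Real.cos_add_two_pi, Real.sin_add_two_pi,
      Real.cos_add_int_mul_two_pi]
  simp only [Fin.sum_univ_four, Fin.forall_fin_succ, Matrix.cons_val, mul_one] at hx
  have hsum : ∀ t, a + b * Real.cos (γ.angle t / m) + c * Real.sin (γ.angle t / m) +
      d * Real.cos (γ.angle t) = F (γ.angle t) := fun t => by simp only [hF, hA]; ring
  simp only [hsum] at hx
  have key := h.integral_nonpos_of_isFStable hstable hper hsmooth hdF hdF' hperF hx.1 hx.2.1
    hx.2.2.1
  -- the divergence part of `F (F'' + F)`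
  set k : ℝ := 1 - 1 / m ^ 2 with hk
  have hk0 : 0 < k := by
    rw [hk, sub_pos, div_lt_one (by positivity)]
    exact hm1
  -- Since $F''+F=a+kA$, one has $F(F''+F)=a^2+kA^2$ plus cross terms. `B` is a periodic
  -- antiderivative of those cross terms in $\theta$, found from $A''=-A/m^2$.
  set B : ℝ → ℝ := fun y => -(a * (1 + k) * m ^ 2 * A' y) + a * d * Real.sin y +
    d * (A' y * Real.cos y + A y * Real.sin y) with hB
  have hdB : ∀ y, HasDerivAt B (a * (1 + k) * A y + a * d * Real.cos y +
      d * k * A y * Real.cos y) y := fun y => by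
    refine HasDerivAt.congr_deriv (((((hdA' y).const_mul (a * (1 + k) * m ^ 2)).neg).add
      ((Real.hasDerivAt_sin y).const_mul (a * d))).add
      ((((hdA' y).mul (Real.hasDerivAt_cos y)).add
        ((hdA y).mul (Real.hasDerivAt_sin y))).const_mul d)) ?_
    rw [hk]
    field_simp
    ring
  have hBint : ∫ t in (0 : ℝ)..γ.period, (a * (1 + k) * A (γ.angle t) +
      a * d * Real.cos (γ.angle t) + d * k * A (γ.angle t) * Real.cos (γ.angle t)) *
      (γ.speed t * γ.curvature t) = 0 := by
    rw [intervalIntegral.integral_eq_sub_of_hasDerivAt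
      (fun t _ => (hdB (γ.angle t)).comp t (γ.hasDerivAt_angle t))
      ((by simp only [hA]; fun_prop : Continuous _).intervalIntegrable _ _)]
    have : B (γ.angle γ.period) = B 0 := by
      have := hAper 0
      rw [zero_add] at this
      have hsin : Real.sin (m * (2 * Real.pi)) = 0 := by
        simpa using Real.sin_add_int_mul_two_pi 0 m
      simp only [hB, hA, hA', hm, this, Real.cos_add_two_pi, Real.sin_add_two_pi,
        Real.cos_int_mul_two_pi, hsin, Real.cos_zero, Real.sin_zero, zero_div]
    simp only [Function.comp_apply, angle_zero, this, sub_self]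
  -- By the first integral, $\kappa^2W\,dt=C\,d\theta$. This is applied to the cross terms only; the
  -- squares keep the weight and stay visibly nonnegative.
  have hsplit : ∀ t, F (γ.angle t) * (γ.curvature t ^ 2 *
      (-(A (γ.angle t) / m ^ 2) - d * Real.cos (γ.angle t) + F (γ.angle t)) +
        F (γ.angle t) / 2) * W t =
      (γ.curvature t ^ 2 * (a ^ 2 + k * A (γ.angle t) ^ 2) + F (γ.angle t) ^ 2 / 2) * W t +
      C * ((a * (1 + k) * A (γ.angle t) + a * d * Real.cos (γ.angle t) +
        d * k * A (γ.angle t) * Real.cos (γ.angle t)) * (γ.speed t * γ.curvature t)) := fun t => by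
    rw [← hC t]
    simp only [hF, hk, hW]
    ring
  have hcont : Continuous fun t => (γ.curvature t ^ 2 * (a ^ 2 + k * A (γ.angle t) ^ 2) +
      F (γ.angle t) ^ 2 / 2) * W t := by
    simp only [hF, hA]
    fun_prop
  have hle : ∫ t in (0 : ℝ)..γ.period, (γ.curvature t ^ 2 * (a ^ 2 + k * A (γ.angle t) ^ 2) +
      F (γ.angle t) ^ 2 / 2) * W t ≤ 0 := by
    refine le_trans (le_of_eq ?_) key
    rw [intervalIntegral.integral_congr fun t _ => hsplit t,
      intervalIntegral.integral_add (hcont.intervalIntegrable _ _)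
        ((by simp only [hA]; fun_prop : Continuous _).intervalIntegrable _ _),
      intervalIntegral.integral_const_mul, hBint, mul_zero, add_zero]
  have hFzero : ∀ t ∈ Icc 0 γ.period, F (γ.angle t) = 0 := fun t ht => by
    by_contra hne
    refine hle.not_gt (intervalIntegral.integral_pos hper hcont.continuousOn
      (fun s _ => mul_nonneg (by positivity) (hWpos s).le) ⟨t, ht, mul_pos ?_ (hWpos t)⟩)
    positivity
  have hF0 : ∀ y, F y = 0 := fun y => by
    obtain ⟨t, rfl⟩ := surjective_angle (γ := γ) (by rw [hm]; positivity) y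
    have hp : Function.Periodic (fun t => F (γ.angle t)) γ.period := fun s => by
      simp only [angle_add_period, hperF (γ.angle s)]
    obtain ⟨s, hs, hst⟩ := hp.exists_mem_Ico₀ hper t
    exact hst.trans (hFzero s ⟨hs.1, hs.2.le⟩)
  have hF0' : ∀ y, A' y - d * Real.sin y = 0 := fun y =>
    (hdF y).unique ((hasDerivAt_const y (0 : ℝ)).congr_of_eventuallyEq (.of_forall hF0))
  have hF0'' : ∀ y, -(A y / m ^ 2) - d * Real.cos y = 0 := fun y =>
    (hdF' y).unique ((hasDerivAt_const y (0 : ℝ)).congr_of_eventuallyEq (.of_forall hF0'))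
  -- The sum of $F=0$ and $F''=0$ eliminates $\cos\theta$. Evaluating where $y/m$ is $0$, $\pi$ and
  -- $\pi/2$ then gives $a\pm kb=0$ and $a+kc=0$, and $F(0)=0$ finally gives $d=0$.
  have hsumF : ∀ y, a + k * A y = 0 := fun y => by
    have e1 := hF0 y
    have e2 := hF0'' y
    simp only [hF] at e1
    rw [hk]
    linear_combination e1 + e2
  have e0 := hsumF 0
  have e1 := hsumF (m * Real.pi)
  have e2 := hsumF (m * (Real.pi / 2))
  have e3 := hF0 0
  simp only [hF, hA, mul_div_cancel_left₀ _ hμ, zero_div, Real.cos_zero, Real.sin_zero,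
    Real.cos_pi, Real.sin_pi, Real.cos_pi_div_two, Real.sin_pi_div_two] at e0 e1 e2 e3
  have ha : a = 0 := by linarith
  have hb : b = 0 := by
    have : k * b = 0 := by linarith
    exact (mul_eq_zero.mp this).resolve_left hk0.ne'
  have hc : c = 0 := by
    have : k * c = 0 := by linarith
    exact (mul_eq_zero.mp this).resolve_left hk0.ne'
  have hd : d = 0 := by linarith
  subst ha hb hc hd
  exact hx0 (by ext i; fin_cases i <;> rfl)

end ImmersedCurve

/-! ### Turning number one: constant curvature and the round circle -/

/-- The global inverse function theorem on the line, for an increasing function. -/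
theorem exists_inverse_hasDerivAt {f v : ℝ → ℝ} (hf : ∀ t, HasDerivAt f (v t) t)
    (hpos : ∀ t, 0 < v t) (hsurj : Function.Surjective f) :
    ∃ g : ℝ → ℝ, (∀ t, g (f t) = t) ∧ (∀ y, f (g y) = y) ∧
      ∀ y, HasDerivAt g (v (g y))⁻¹ y := by
  have hmono : StrictMono f := strictMono_of_deriv_pos fun t => by
    rw [(hf t).deriv]
    exact hpos t
  set E := hmono.orderIsoOfSurjective f hsurj
  have hfE : ∀ y, f (E.symm y) = y := fun y => E.apply_symm_apply y
  exact ⟨E.symm, fun t => E.symm_apply_apply t, hfE, fun y =>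
    HasDerivAt.of_local_left_inverse E.symm.continuous.continuousAt (hf _) (hpos _).ne'
      (.of_forall hfE)⟩

theorem exists_cos_sin_eq {a b : ℝ} (h : a ^ 2 + b ^ 2 = 1) :
    ∃ y, Real.cos y = a ∧ Real.sin y = b := by
  have hz : ‖(⟨a, b⟩ : ℂ)‖ = 1 := by
    rw [Complex.norm_def, Complex.normSq_mk, ← sq, ← sq, h, Real.sqrt_one]
  have hz0 : (⟨a, b⟩ : ℂ) ≠ 0 := fun h0 => by simp [h0] at hz
  exact ⟨Complex.arg ⟨a, b⟩, by rw [Complex.cos_arg hz0, hz, div_one],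
    by rw [Complex.sin_arg, hz, div_one]⟩

namespace ImmersedCurve

variable {γ : ImmersedCurve (EuclideanSpace ℝ (Fin 2))}

theorem strictMono_angle {σ : ℝ} (hκ : ∀ t, 0 < σ * γ.curvature t) :
    StrictMono fun t => σ * γ.angle t := strictMono_of_deriv_pos fun t => by
  rw [((γ.hasDerivAt_angle t).const_mul σ).deriv]
  nlinarith [mul_pos (γ.speed_pos t) (hκ t)]

theorem angle_period_ne_zero {m : ℤ} (hm : γ.angle γ.period = m * (2 * Real.pi))
    (hm1 : (m : ℝ) ^ 2 = 1) : γ.angle γ.period ≠ 0 := by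
  have h0 : (m : ℝ) ≠ 0 := fun h0 => by simp [h0] at hm1
  rw [hm]
  exact mul_ne_zero h0 Real.two_pi_pos.ne'

/-- A closed shrinker of turning number `±1` has constant curvature. -/
theorem IsShrinker.sq_curvature_of_turning (h : γ.IsShrinker) {σ : ℝ} (hσ : σ ^ 2 = 1)
    (hκ : ∀ t, 0 < σ * γ.curvature t) {m : ℤ} (hm : γ.angle γ.period = m * (2 * Real.pi))
    (hm1 : (m : ℝ) ^ 2 = 1) (t : ℝ) : γ.curvature t ^ 2 = 1 / 2 := by
  have hσ0 : σ ≠ 0 := fun h0 => by simp [h0] at hσ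
  have hm0 : γ.angle γ.period ≠ 0 := angle_period_ne_zero hm hm1
  have hκ0 : ∀ t, γ.curvature t ≠ 0 := fun t h0 => by simpa [h0] using hκ t
  obtain ⟨τ, hτ1, hτ2, hτ⟩ := exists_inverse_hasDerivAt (f := fun t => σ * γ.angle t)
    (fun t => (γ.hasDerivAt_angle t).const_mul σ)
    (fun t => by nlinarith [mul_pos (γ.speed_pos t) (hκ t)])
    (fun y => (surjective_angle hm0 (y / σ)).imp fun t ht => by
      simp only [ht]
      field_simp)
  -- In the increasing angle $\sigma\theta$ the first order system for $\kappa$ and $\langle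
  -- x,T\rangle$ becomes $p'=r$, $r'=2/p-p$ with $p=2\sigma\kappa$ and $r=\langle x,T\rangle$.
  have hsol : IsSupportSolution (fun y => 2 * (σ * γ.curvature (τ y))) (fun y => γ.radial (τ y)) :=
    { pos := fun y => mul_pos two_pos (hκ _)
      hasDerivAt := fun y => by
        refine (((h.hasDerivAt_curvature _).comp y (hτ y)).const_mul σ).const_mul 2 |>.congr_deriv ?_
        have := (γ.speed_pos (τ y)).ne'
        have := hκ0 (τ y)
        field_simp
      hasDerivAt' := fun y => by
        refine ((h.hasDerivAt_radial _).comp y (hτ y)).congr_deriv ?_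
        have := (γ.speed_pos (τ y)).ne'
        have := hκ0 (τ y)
        field_simp
        linear_combination 2 * γ.curvature (τ y) ^ 2 * hσ }
  have hshift : ∀ y, τ (y + σ * m * (2 * Real.pi)) = τ y + γ.period := fun y => by
    rw [← hτ1 (τ y + γ.period), angle_add_period, mul_add, hτ2, hm, mul_assoc]
  have hperiod : Function.Periodic (fun y => 2 * (σ * γ.curvature (τ y))) (2 * Real.pi) := by
    have h1 : Function.Periodic (fun y => 2 * (σ * γ.curvature (τ y))) (σ * m * (2 * Real.pi)) :=
      fun y => by simp only [hshift, γ.periodic_curvature (τ y)]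
    have h2 : (σ * m) ^ 2 = 1 := by rw [mul_pow, hσ, hm1, one_mul]
    -- Both signs of $\sigma m=\pm1$ are treated alike, as the negative of a period is a period.
    rcases mul_self_eq_one_iff.mp ((sq _).symm.trans h2) with h3 | h3
    · rwa [h3, one_mul] at h1
    · rw [h3, neg_one_mul] at h1
      simpa using h1.neg
  have h1 := hsol.eq_sqrt_two hperiod (σ * γ.angle t)
  simp only [hτ1] at h1
  have h2 : (2 * (σ * γ.curvature t)) ^ 2 = 2 := by rw [h1, Real.sq_sqrt zero_le_two]
  linear_combination h2 / 4 - γ.curvature t ^ 2 * hσ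

/-- A closed shrinker of turning number `±1` is the circle of radius `√2`, covered once. -/
theorem IsShrinker.circle_of_turning (h : γ.IsShrinker) (hper : 0 < γ.period) {σ : ℝ}
    (hσ : σ ^ 2 = 1) (hκ : ∀ t, 0 < σ * γ.curvature t) {m : ℤ}
    (hm : γ.angle γ.period = m * (2 * Real.pi)) (hm1 : (m : ℝ) ^ 2 = 1) :
    Set.InjOn γ γ.domain ∧
      Set.range γ = Metric.sphere (0 : EuclideanSpace ℝ (Fin 2)) (Real.sqrt 2) := by
  have hsq := h.sq_curvature_of_turning hσ hκ hm hm1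
  have hκ0 : ∀ t, γ.curvature t ≠ 0 := fun t h0 => by simpa [h0] using hκ t
  have hconst : ∀ t, σ * γ.curvature t = σ * γ.curvature 0 := fun t =>
    (sq_eq_sq₀ (hκ t).le (hκ 0).le).mp (by rw [mul_pow, mul_pow, hsq, hsq])
  have hσ0 : σ ≠ 0 := fun h0 => by simp [h0] at hσ
  have hcurv : ∀ t, γ.curvature t = γ.curvature 0 := fun t => mul_left_cancel₀ hσ0 (hconst t)
  have hrad : ∀ t, γ.radial t = 0 := fun t => by
    have h1 := h.hasDerivAt_curvature t
    rw [funext hcurv] at h1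
    have h2 := h1.unique (hasDerivAt_const t _)
    simpa [(γ.speed_pos t).ne', hκ0] using h2
  have hγ : ∀ t, γ t = (-(2 * γ.curvature 0)) • γ.unitNormal t := fun t => by
    rw [h.toFun_eq t, hrad, zero_smul, zero_add, hcurv t]
  have hc0 : -(2 * γ.curvature 0) ≠ 0 := by simpa using hκ0 0
  have hangle0 : γ.angle γ.period ≠ 0 := angle_period_ne_zero hm hm1
  constructor
  · have hmono := strictMono_angle hκ
    have hσ1 : |σ| = 1 := by rw [← pow_eq_one_iff_of_nonneg (abs_nonneg _) two_ne_zero, sq_abs, hσ]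
    have habs : |σ * γ.angle γ.period| = 2 * Real.pi := by
      have h2 : |(m : ℝ)| = 1 := by
        rw [← pow_eq_one_iff_of_nonneg (abs_nonneg _) two_ne_zero, sq_abs, hm1]
      rw [hm, abs_mul, abs_mul, hσ1, h2, one_mul, one_mul, abs_of_pos Real.two_pi_pos]
    have hpos : 0 < σ * γ.angle γ.period := by simpa [angle_zero] using hmono hper
    rw [abs_of_pos hpos] at habs
    rw [domain_of_period_pos hper]
    intro s hs t ht hst
    have hT : γ.tangent s = γ.tangent t := by
      have h1 := smul_right_injective _ hc0 ((hγ s).symm.trans (hst.trans (hγ t)))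
      have h2 := congrArg planeRotation h1
      simpa [unitNormal, planeRotation_planeRotation] using h2
    obtain ⟨n, hn⟩ := (γ.tangent_eq_iff s t).mp hT
    -- Over the half-open domain the angle stays within one full turn, so equal tangents, whose
    -- angles differ by $2\pi n$, force $n=0$.
    have hrange : ∀ t ∈ Ico 0 γ.period, 0 ≤ σ * γ.angle t ∧ σ * γ.angle t < 2 * Real.pi :=
      fun t ht => ⟨by simpa [angle_zero] using hmono.monotone ht.1, habs ▸ hmono ht.2⟩
    have h1 := hrange s hs
    have h2 := hrange t ht
    have h3 : |(n : ℝ)| < 1 := by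
      have h4 : |σ * (n * (2 * Real.pi))| < 2 * Real.pi := by
        rw [hn, mul_sub, abs_lt]
        constructor <;> linarith [h1.1, h1.2, h2.1, h2.2]
      rw [abs_mul, hσ1, one_mul, abs_mul, abs_of_pos Real.two_pi_pos] at h4
      exact lt_of_mul_lt_mul_right (by simpa using h4) Real.two_pi_pos.le
    have hn0 : n = 0 := by
      rw [← Int.cast_abs] at h3
      exact Int.abs_lt_one_iff.mp (by exact_mod_cast h3)
    refine hmono.injective (congrArg (σ * ·) ?_)
    rw [hn0, Int.cast_zero, zero_mul] at hn
    linarith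
  · ext z
    rw [mem_sphere_zero_iff_norm]
    constructor
    · rintro ⟨t, rfl⟩
      rw [← Real.sqrt_sq (norm_nonneg (γ t)), h.norm_sq t, hrad, hsq]
      norm_num
    · intro hz
      -- The tangent that the circle must have at $z$: solve $z=-2\kappa Ju$ with the rotation $J$,
      -- using $J^2=-1$.
      set u := (2 * γ.curvature 0)⁻¹ • planeRotation z with hu
      have huu : ⟪u, u⟫ = 1 := by
        rw [hu, real_inner_smul_left, real_inner_smul_right, inner_planeRotation_planeRotation,
          real_inner_self_eq_norm_sq, hz, Real.sq_sqrt zero_le_two]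
        have := hsq 0
        have := hκ0 0
        field_simp
        linarith
      have hudec := γ.eq_tangent_add_unitNormal 0 u
      have hab : ⟪u, γ.tangent 0⟫ ^ 2 + ⟪u, γ.unitNormal 0⟫ ^ 2 = 1 := by
        rw [← huu]
        conv_rhs => rw [hudec]
        simp only [inner_add_left, inner_add_right, real_inner_smul_left, real_inner_smul_right,
          inner_tangent_unitNormal, inner_unitNormal_tangent, inner_tangent_self,
          inner_unitNormal_self]
        ring
      obtain ⟨y, hy1, hy2⟩ := exists_cos_sin_eq hab
      obtain ⟨t, rfl⟩ := surjective_angle hangle0 y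
      have hTu : γ.tangent t = u := by
        rw [hudec, γ.eq_tangent_add_unitNormal 0 (γ.tangent t), (γ.inner_tangent_zero t).1,
          (γ.inner_tangent_zero t).2, hy1, hy2]
      refine ⟨t, ?_⟩
      rw [hγ, unitNormal, hTu, hu, map_smul, planeRotation_planeRotation, smul_smul, smul_neg,
        ← neg_smul]
      have : -(-(2 * γ.curvature 0) * (2 * γ.curvature 0)⁻¹) = 1 := by
        have := hκ0 0
        field_simp
      rw [this, one_smul]

end ImmersedCurve

/-! ### The classification -/

/-- A complete immersed `F`-stable shrinking curve in the plane with finite entropy is, with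
multiplicity one, a line through the origin or the circle of radius `√2` about the origin. -/
theorem mainTheorem7 (γ : ImmersedCurve (EuclideanSpace ℝ (Fin 2)))
    (hcomplete : γ.IsComplete) (hshrinker : γ.IsShrinker) (hstable : γ.IsFStable)
    (hentropy : γ.entropy < ⊤) :
    Set.InjOn γ γ.domain ∧
      ((∃ ℓ : Submodule ℝ (EuclideanSpace ℝ (Fin 2)),
          Module.finrank ℝ ℓ = 1 ∧ Set.range γ = (ℓ : Set (EuclideanSpace ℝ (Fin 2)))) ∨
        Set.range γ = Metric.sphere (0 : EuclideanSpace ℝ (Fin 2)) (Real.sqrt 2)) := by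
  obtain ⟨C, hC⟩ := hshrinker.exists_curvature_mul_exp
  rcases eq_or_ne C 0 with rfl | hC0
  · obtain ⟨h1, h2⟩ := hshrinker.line_of_curvature_eq_zero hcomplete fun t =>
      (mul_eq_zero.mp (hC t)).resolve_right (Real.exp_pos _).ne'
    exact ⟨h1, Or.inl h2⟩
  have hper := hshrinker.period_pos hcomplete hentropy hC0 hC
  -- `σ` is the sign of $C$, hence of the curvature everywhere; it absorbs the orientation.
  obtain ⟨σ, hσ, hσC⟩ : ∃ σ : ℝ, σ ^ 2 = 1 ∧ 0 < σ * C := by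
    rcases lt_or_gt_of_ne hC0 with h | h
    · exact ⟨-1, by norm_num, by linarith⟩
    · exact ⟨1, by norm_num, by linarith⟩
  have hκ : ∀ t, 0 < σ * γ.curvature t := fun t => by
    rw [← hC t, ← mul_assoc] at hσC
    exact pos_of_mul_pos_left hσC (Real.exp_pos _).le
  obtain ⟨m, hm⟩ := γ.exists_angle_period
  have hm0 : m ≠ 0 := fun h0 => by
    have hpos : 0 < σ * γ.angle γ.period := by
      simpa [ImmersedCurve.angle_zero] using ImmersedCurve.strictMono_angle hκ hper
    simp [hm, h0] at hpos
  have hm1 : (m : ℝ) ^ 2 = 1 := by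
    refine le_antisymm (hshrinker.sq_turning_lt hstable hper hC hm0 hm) ?_
    exact_mod_cast Int.one_le_abs (pow_ne_zero 2 hm0) |>.trans_eq (abs_of_nonneg (sq_nonneg m))
  obtain ⟨h1, h2⟩ := hshrinker.circle_of_turning hper hσ hκ hm hm1
  exact ⟨h1, Or.inr h2⟩
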